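/- Let $K$ be an algebraically closed field, let $N\ge 0$, $1\le c\le N+1$ and $d_1,\dots,d_c\ge 1$ be integers, and let $V=\bigoplus_{i=1}^{c}H^0(\mathbb P^N_K,\mathcal O(d_i))$ be the space of tuples $(F_1,\dots,F_c)$ of homogeneous polynomials of degrees $d_1,\dots,d_c$ in $X_0,\dots,X_N$. Let $D\subset V$ be the discriminant locus: the set of tuples such that the closed subscheme $\{F_1=\dots=F_c=0\}$ of $\mathbb P^N_K$ is not smooth of codimension $c$ (for $c=N+1$, smooth of codimension $c$ means empty). Let $\tilde T$ be the torus whose character lattice consists of the Laurent monomials $Y_1^{\alpha_1}\cdots Y_c^{\alpha_c}X_0^{\beta_0}\cdots X_N^{\beta_N}$ with $\sum_i d_i\alpha_i=\sum_j\beta_j$, and let $$A=\{\,Y_iX_0^{e_0}\cdots X_N^{e_N} : 1\le i\le c,\ e_j\ge 0,\ \textstyle\sum_j e_j=d_i\,\},$$ a finite set of characters of $\tilde T$. Let $\tilde X_A\subset (K^A)^*$ be the Zariski closure of the set of points $(\chi(t))_{\chi\in A}$, $t\in\tilde T$; it is a cone. Let $X_A\subset\mathbb P((K^A)^*)$ be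 its projectivization, $X_A^\vee\subset\mathbb P(K^A)$ the projective dual of $X_A$ (the Zariski closure of the set of hyperplanes that contain the projective tangent space of $X_A$ at some smooth point), and $\tilde X_A^\vee\subset K^A$ the affine cone over $X_A^\vee$ (which contains the origin by definition). Identify $V$ with $K^A$ by sending $(F_1,\dots,F_c)$ to the coefficients of $\sum_i Y_iF_i$. Then $$D=\tilde X_A^\vee .$$ In particular $D$ is Zariski closed. -/

import Mathlib

open scoped LinearAlgebra.Projectivization

/-! ### Projective varieties in coordinates -/

section Projective

variable {K : Type*} [Field K] {ι : Type*}

/-- The Zariski closure in `ℙ(K^ι)`: the common zeros of all homogeneous polynomials vanishing on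
`S`. -/
def projClosure (S : Set (ℙ K (ι → K))) : Set (ℙ K (ι → K)) :=
  {p | ∀ (n : ℕ) (f : MvPolynomial ι K), f.IsHomogeneous n →
    (∀ q ∈ S, MvPolynomial.eval q.rep f = 0) → MvPolynomial.eval p.rep f = 0}

/-- The affine cone over `X ⊆ ℙ(K^ι)`: the origin together with all vectors whose class is in
`X`. -/
def affineCone (X : Set (ℙ K (ι → K))) : Set (ι → K) :=
  {v | ∀ hv : v ≠ 0, Projectivization.mk K v hv ∈ X}

/-- The homogeneous ideal of `X ⊆ ℙ(K^ι)`, that is, the ideal of its affine cone. -/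
noncomputable def coneIdeal (X : Set (ℙ K (ι → K))) : Ideal (MvPolynomial ι K) :=
  MvPolynomial.vanishingIdeal K (affineCone X)

/-- The homogeneous coordinate ring of `X`. -/
abbrev homogCoordRing (X : Set (ℙ K (ι → K))) : Type _ :=
  MvPolynomial ι K ⧸ coneIdeal X

/-- `x` is a smooth point of the (reduced) variety `X`. As the punctured affine cone is a
`𝔾ₘ`-torsor over `X`, this is read on the cone: the prime of the homogeneous coordinate ring given
by a representative of `x` lies in the smooth locus over `K`. -/
def IsSmoothPoint (X : Set (ℙ K (ι → K))) (x : ℙ K (ι → K)) : Prop :=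
  ∃ p ∈ Algebra.smoothLocus K (homogCoordRing X),
    PrimeSpectrum.comap (Ideal.Quotient.mk (coneIdeal X)) p = MvPolynomial.pointToPoint x.rep

variable [Fintype ι]

/-- The (linear) Zariski tangent space at `x` of the affine cone over `X`; its projectivization is
the embedded projective tangent space of `X` at `x`. -/
noncomputable def coneTangentSpace (X : Set (ℙ K (ι → K))) (x : ℙ K (ι → K)) :
    Submodule K (ι → K) where
  carrier := {v | ∀ f ∈ coneIdeal X,
    ∑ a, MvPolynomial.eval x.rep (MvPolynomial.pderiv a f) * v a = 0}
  zero_mem' := by simp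
  add_mem' := by
    intro v w hv hw f hf
    simp only [Pi.add_apply, mul_add, Finset.sum_add_distrib]
    rw [hv f hf, hw f hf, add_zero]
  smul_mem' := by
    intro r v hv f hf
    have h := congrArg (r * ·) (hv f hf)
    simp only [Finset.mul_sum, mul_zero] at h
    rw [← h]
    exact Finset.sum_congr rfl fun a _ => by simp only [Pi.smul_apply, smul_eq_mul]; ring

/-- The hyperplane `∑ H_a z_a = 0` is tangent to `X` at `x`: it contains the tangent space of `X`
at `x`. (The dual projective space is given the dual coordinates, so that a hyperplane is again a
point of `ℙ(K^ι)`.) -/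
def IsTangentAt (X : Set (ℙ K (ι → K))) (H x : ℙ K (ι → K)) : Prop :=
  ∀ v ∈ coneTangentSpace X x, ∑ a, H.rep a * v a = 0

/-- The projective dual `X^∨`: the Zariski closure of the set of hyperplanes tangent to `X` at some
smooth point of `X`. -/
def projectiveDual (X : Set (ℙ K (ι → K))) : Set (ℙ K (ι → K)) :=
  projClosure {H | ∃ x ∈ X, IsSmoothPoint X x ∧ IsTangentAt X H x}

end Projective

/-! ### Toric varieties given by finitely many characters -/

section Toric

variable (K : Type*) [Field K] {M ι : Type*} [AddCommGroup M]

/-- The group of `K`-points of the torus with character lattice `M`. -/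
abbrev TorusPoints (M : Type*) [AddCommGroup M] : Type _ := Multiplicative M →* Kˣ

/-- The affine toric variety of a family of characters `χ`: the Zariski closure of the set of points
`(χ_a(t))_a`, for `t` in the torus. -/
def affineToric (χ : ι → M) : Set (ι → K) :=
  MvPolynomial.zeroLocus K (MvPolynomial.vanishingIdeal K
    (Set.range fun (t : TorusPoints K M) (a : ι) => ((t (Multiplicative.ofAdd (χ a)) : Kˣ) : K)))

/-- The projective toric variety of `χ`: the projectivization of the affine one (which is a cone in
the case of interest, where some linear form takes the value `1` on all the `χ_a`). -/
def projToric (χ : ι → M) : Set (ℙ K (ι → K)) :=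
  {p | p.rep ∈ affineToric K χ}

end Toric

/-! ### The set `A` of monomials `Y_i X^e`, `|e| = d_i` -/

section Monomials

variable {c N : ℕ} (d : Fin c → ℕ)

/-- The lattice of all `(α, β)`, standing for the Laurent monomials `Y^α X^β`, such that
`∑ d_i α_i = ∑ β_j`. -/
def charLattice (N : ℕ) : AddSubgroup ((Fin c → ℤ) × (Fin (N + 1) → ℤ)) where
  carrier := {m | ∑ i, (d i : ℤ) * m.1 i = ∑ j, m.2 j}
  zero_mem' := by simp
  add_mem' := by
    intro m m' h h'
    simp only [Set.mem_ofPred_eq, Prod.fst_add, Prod.snd_add, Pi.add_apply, mul_add,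
      Finset.sum_add_distrib] at *
    rw [h, h']
  neg_mem' := by
    intro m h
    simpa using h

noncomputable instance fintypeExponents (n : ℕ) :
    Fintype {e : Fin (N + 1) →₀ ℕ // e.degree = n} :=
  Fintype.subtype (Finset.univ.finsuppAntidiag n) fun e => by
    simp [Finset.mem_finsuppAntidiag, Finsupp.degree_eq_sum]

/-- The index set of `A`: the pairs `(i, e)` with `|e| = d_i`. -/
abbrev MonomialIndex (N : ℕ) (d : Fin c → ℕ) : Type :=
  Σ i : Fin c, {e : Fin (N + 1) →₀ ℕ // e.degree = d i}

/-- The monomial `Y_i X^e`, as an element of the lattice. -/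
def monomialChar (a : MonomialIndex N d) : charLattice d N :=
  ⟨(Pi.single a.1 1, fun j => (a.2.1 j : ℤ)), by
    have h : (∑ j, (a.2.1 j : ℤ)) = (d a.1 : ℤ) := by
      have h' := congrArg (Nat.cast (R := ℤ)) a.2.2
      rw [Finsupp.degree_eq_sum, Nat.cast_sum] at h'
      exact h'
    change ∑ i, (d i : ℤ) * (Pi.single a.1 1 : Fin c → ℤ) i = ∑ j, (a.2.1 j : ℤ)
    rw [h]
    simp [Pi.single_apply]⟩

/-- The monomials `Y_i X^e` are pairwise distinct. -/
theorem monomialChar_injective : Function.Injective (monomialChar (N := N) d) := by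
  rintro ⟨i, e, he⟩ ⟨i', e', he'⟩ h
  have h1 : (Pi.single i 1 : Fin c → ℤ) = Pi.single i' 1 :=
    congrArg (fun m : charLattice d N => m.1.1) h
  have h2 : (fun j => (e j : ℤ)) = fun j => (e' j : ℤ) :=
    congrArg (fun m : charLattice d N => m.1.2) h
  have hi : i = i' := by
    by_contra hne
    have := congrFun h1 i
    simp [hne] at this
  have hee : e = e' := Finsupp.ext fun j => by exact_mod_cast congrFun h2 j
  subst hi
  subst hee
  rfl

end Monomials

/-! ### Tuples of forms and the discriminant locus -/

section Discriminant

variable (K : Type*) [Field K] {c : ℕ} (N : ℕ) (d : Fin c → ℕ)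

/-- `V = ⨁ H⁰(ℙ^N, 𝒪(d_i))`: tuples of forms of degrees `d_i` in `X_0, …, X_N`. -/
abbrev FormTuple : Type _ :=
  ∀ i : Fin c, MvPolynomial.homogeneousSubmodule (Fin (N + 1)) K (d i)

/-- The identification `V = K^A`, sending `(F_i)` to the coefficients of `∑ Y_i F_i`. -/
noncomputable def coeffEquiv : FormTuple K N d ≃ₗ[K] (MonomialIndex N d → K) where
  toFun F a := MvPolynomial.coeff a.2.1 (F a.1 : MvPolynomial (Fin (N + 1)) K)
  map_add' F G := by
    ext a
    simp
  map_smul' r F := by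
    ext a
    simp
  invFun w i := ⟨∑ e : {e : Fin (N + 1) →₀ ℕ // e.degree = d i},
      MvPolynomial.monomial e.1 (w ⟨i, e⟩),
    Submodule.sum_mem _ fun e _ => MvPolynomial.isHomogeneous_monomial _ e.2⟩
  left_inv F := by
    funext i
    apply Subtype.ext
    apply MvPolynomial.ext
    intro m
    simp only [MvPolynomial.coeff_sum, MvPolynomial.coeff_monomial]
    by_cases hm : m.degree = d i
    · rw [Finset.sum_eq_single ⟨m, hm⟩]
      · simp
      · intro b _ hb
        rw [if_neg fun h => hb (Subtype.ext h)]
      · simp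
    · rw [Finset.sum_eq_zero]
      · symm
        exact MvPolynomial.IsHomogeneous.coeff_eq_zero (F i).2 hm
      · intro b _
        rw [if_neg]
        rintro rfl
        exact hm b.2
  right_inv w := by
    funext a
    obtain ⟨i, e⟩ := a
    simp only [MvPolynomial.coeff_sum, MvPolynomial.coeff_monomial]
    rw [Finset.sum_eq_single e]
    · simp
    · intro b _ hb
      rw [if_neg fun h => hb (Subtype.ext h)]
    · simp

variable {K N d}

/-- The coordinate ring `K[X_0, …, X_N] / (F_1, …, F_c, X_j - 1)` of the affine open subscheme
`X_j ≠ 0` of the closed subscheme `{F_1 = … = F_c = 0}` of `ℙ^N`. -/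
abbrev chartRing (F : FormTuple K N d) (j : Fin (N + 1)) : Type _ :=
  MvPolynomial (Fin (N + 1)) K ⧸
    Ideal.span (insert (MvPolynomial.X j - 1 : MvPolynomial (Fin (N + 1)) K)
      (Set.range fun i => (F i : MvPolynomial (Fin (N + 1)) K)))

/-- The scheme `{F_1 = … = F_c = 0} ⊆ ℙ^N` is smooth over `K` of codimension `c`: around every point
of every affine chart it is smooth of relative dimension `n` over `K`, where `n + c = N`. (If
`c = N + 1` there is no such `n`, so this says that the scheme is empty.) -/
def IsSmoothOfCodim (F : FormTuple K N d) : Prop :=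
  ∀ (j : Fin (N + 1)) (p : PrimeSpectrum (chartRing F j)), ∃ n : ℕ, n + c = N ∧
    ∃ g ∉ p.asIdeal, Algebra.IsStandardSmoothOfRelativeDimension n K (Localization.Away g)

variable (K N d)

/-- The discriminant locus `D ⊆ V`. -/
def discriminantLocus : Set (FormTuple K N d) :=
  {F | ¬ IsSmoothOfCodim F}

end Discriminant

/-! Put `φ(y, z) = (y_i z^e)`. A linear form on the ambient space of the cone over `X_A` pulls back
along `φ` to `∑ Y_i F_i`, where `F` is the tuple whose coefficients are those of the form.

Every nonzero point of the cone is `φ(y, z)` with `y ≠ 0` and `z ≠ 0`. Near such a point some vertex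
coordinate `Y_i X_j^{d_i}` is invertible, and there binomial relations invert `φ` up to scaling,
even for points with values in a `K`-algebra. Two facts follow: `X_A` is smooth
(`isSmoothPoint_projToric`), and every tangent vector of the cone at `φ(y, z)` comes from a
first-order deformation of `(y, z)`. So a hyperplane is tangent at `φ(y, z)` exactly when all
partial derivatives of `∑ Y_i F_i` vanish at `(y, z)`, that is, `F_i(z) = 0` for all `i` and `∑ y_i
dF_i(z) = 0`. This is `IsSingularAt`; see `exists_isTangentAt_iff`.

By the Jacobian criterion such a pair with `y ≠ 0`, `z ≠ 0` exists exactly when the scheme is not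
smooth of codimension `c` (`isSmoothOfCodim_iff`). Hence `D` agrees with the tangent hyperplanes
before any closure is taken. Elimination theory (`exists_isHomogeneous_of_forall_not_isSingularAt`)
shows that this set is already closed. -/

/-! ### The monomial parametrization -/

section Parametrization

variable {c N : ℕ} {d : Fin c → ℕ}

/-- The point with coordinates `y_i z^e`. -/
def paramPoint (d : Fin c → ℕ) {C : Type*} [CommRing C] (y : Fin c → C) (z : Fin (N + 1) → C) :
    MonomialIndex N d → C :=
  fun a => y a.1 * ∏ j, z j ^ a.2.1 j

/-- The index `Y_i X_j^{d_i}`. -/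
noncomputable def vertexIndex (d : Fin c → ℕ) (i : Fin c) (j : Fin (N + 1)) : MonomialIndex N d :=
  ⟨i, Finsupp.single j (d i), by simp⟩

/-- The index `Y_i X_j^{d_i - 1} X_l`. -/
noncomputable def edgeIndex (hd : ∀ i, 1 ≤ d i) (i : Fin c) (j l : Fin (N + 1)) :
    MonomialIndex N d :=
  ⟨i, Finsupp.single j (d i - 1) + Finsupp.single l 1, by
    have := hd i
    simp only [map_add, Finsupp.degree_single]
    omega⟩

theorem paramPoint_vertexIndex {C : Type*} [CommRing C] (y : Fin c → C) (z : Fin (N + 1) → C)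
    (i : Fin c) (j : Fin (N + 1)) :
    paramPoint d y z (vertexIndex d i j) = y i * z j ^ d i := by
  simp only [paramPoint, vertexIndex, Finsupp.single_apply]
  simp [pow_ite]

theorem paramPoint_edgeIndex {C : Type*} [CommRing C] (hd : ∀ i, 1 ≤ d i) (y : Fin c → C)
    (z : Fin (N + 1) → C) (i : Fin c) (j l : Fin (N + 1)) :
    paramPoint d y z (edgeIndex hd i j l) = y i * z j ^ (d i - 1) * z l := by
  simp only [paramPoint, edgeIndex, Finsupp.add_apply, Finsupp.single_apply, pow_add,
    Finset.prod_mul_distrib, mul_assoc]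
  simp [pow_ite]

theorem sum_exponents {n : ℕ} (e : {e : Fin (N + 1) →₀ ℕ // e.degree = n}) :
    ∑ j, e.1 j = n := by
  rw [← Finsupp.degree_eq_sum, e.2]

theorem prod_mul_pow_exponents {C : Type*} [CommRing C] {n : ℕ}
    (e : {e : Fin (N + 1) →₀ ℕ // e.degree = n}) (u : C) (z : Fin (N + 1) → C) :
    ∏ j, (u * z j) ^ e.1 j = u ^ n * ∏ j, z j ^ e.1 j := by
  simp only [mul_pow, Finset.prod_mul_distrib]
  rw [Finset.prod_pow_eq_pow_sum, sum_exponents]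

variable (K : Type*) [Field K]

/-- The homomorphism sending the coordinate of index `(i, e)` to `Y_i X^e`. -/
noncomputable def paramHom (N : ℕ) (d : Fin c → ℕ) :
    MvPolynomial (MonomialIndex N d) K →ₐ[K] MvPolynomial (Fin c ⊕ Fin (N + 1)) K :=
  MvPolynomial.aeval (paramPoint d (fun i => MvPolynomial.X (Sum.inl i))
    (fun j => MvPolynomial.X (Sum.inr j)))

variable {K}

theorem aeval_paramPoint {C : Type*} [CommRing C] [Algebra K C] (y : Fin c → C)
    (z : Fin (N + 1) → C) (f : MvPolynomial (MonomialIndex N d) K) :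
    MvPolynomial.aeval (paramPoint d y z) f =
      MvPolynomial.aeval (Sum.elim y z) (paramHom K N d f) := by
  have : (MvPolynomial.aeval (paramPoint d y z) : MvPolynomial (MonomialIndex N d) K →ₐ[K] C) =
      (MvPolynomial.aeval (Sum.elim y z)).comp (paramHom K N d) := by
    ext a
    simp [paramHom, paramPoint]
  rw [this]
  rfl

/-- These binomials are the only equations needed to invert the parametrization where the coordinate
`Y_i X_j^{d_i}` is a unit. -/
theorem relation_mem_ker_paramHom (hd : ∀ i, 1 ≤ d i) (i : Fin c) (j : Fin (N + 1))
    (a : MonomialIndex N d) :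
    (MvPolynomial.X a * MvPolynomial.X (vertexIndex d i j) ^ d a.1 -
      MvPolynomial.X (vertexIndex d a.1 j) *
        ∏ l, MvPolynomial.X (edgeIndex hd i j l) ^ a.2.1 l : MvPolynomial _ K) ∈
      RingHom.ker (paramHom K N d) := by
  rw [RingHom.mem_ker]
  simp only [map_sub, map_mul, map_pow, map_prod, paramHom, MvPolynomial.aeval_X,
    paramPoint_vertexIndex, paramPoint_edgeIndex]
  rw [prod_mul_pow_exponents]
  obtain ⟨k, e⟩ := a
  obtain ⟨n, hn⟩ := Nat.exists_eq_add_of_le' (hd i)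
  simp only [paramPoint, hn, Nat.add_sub_cancel]
  ring

/-- A point with values in a `K`-algebra that satisfies the equations of the toric variety is in
the image of the parametrization as soon as one of its vertex coordinates is invertible. -/
theorem eq_paramPoint {C : Type*} [CommRing C] [Algebra K C] (hd : ∀ i, 1 ≤ d i)
    (W : MonomialIndex N d → C)
    (hW : ∀ f ∈ RingHom.ker (paramHom K N d), MvPolynomial.aeval W f = 0)
    (i : Fin c) (j : Fin (N + 1)) (t : C) (ht : W (vertexIndex d i j) * t = 1)
    (u u' : C) (hu : u * u' = 1) :
    W = paramPoint d (fun k => u' ^ d k * W (vertexIndex d k j))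
      (fun l => u * (t * W (edgeIndex hd i j l))) := by
  funext a
  -- The binomial expresses `W a` once it is divided by a power of the vertex coordinate. The pair
  -- `u`, `u'` records the freedom `(y_k, z) ↦ (u'^{d_k} y_k, u z)`, which does not move the point.
  have h := hW _ (relation_mem_ker_paramHom hd i j a)
  simp only [map_sub, map_mul, map_pow, map_prod, MvPolynomial.aeval_X, sub_eq_zero] at h
  simp only [paramPoint]
  rw [prod_mul_pow_exponents, prod_mul_pow_exponents]
  have h1 : W (vertexIndex d i j) ^ d a.1 * t ^ d a.1 = 1 := by rw [← mul_pow, ht, one_pow]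
  have h2 : u ^ d a.1 * u' ^ d a.1 = 1 := by rw [← mul_pow, hu, one_pow]
  linear_combination t ^ d a.1 * h - W a * h1 - t ^ d a.1 * W (vertexIndex d a.1 j) *
    (∏ l, W (edgeIndex hd i j l) ^ a.2.1 l) * h2

end Parametrization

/-! ### The ideal and the points of the toric variety. -/

section ToricIdeal

variable {c N : ℕ} {d : Fin c → ℕ} {K : Type*} [Field K]

/-- The lattice element `Y_i X^e` in terms of the vertices and edges at `Y_i X_j^{d_i}`. -/
theorem monomialChar_eq (hd : ∀ i, 1 ≤ d i) (i : Fin c) (j : Fin (N + 1))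
    (a : MonomialIndex N d) :
    monomialChar d a = monomialChar d (vertexIndex d a.1 j) +
      ∑ l, a.2.1 l • (monomialChar d (edgeIndex hd i j l) - monomialChar d (vertexIndex d i j)) := by
  apply Subtype.ext
  have hsum : ((∑ l, a.2.1 l • (monomialChar d (edgeIndex hd i j l) -
      monomialChar d (vertexIndex d i j)) : charLattice d N) : (Fin c → ℤ) × (Fin (N + 1) → ℤ)) =
      ∑ l, a.2.1 l • ((monomialChar d (edgeIndex hd i j l)).1 -
        (monomialChar d (vertexIndex d i j)).1) := by
    rw [AddSubgroup.val_finsetSum]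
    rfl
  rw [AddSubgroup.coe_add, hsum]
  have hdi := hd i
  apply Prod.ext
  · rw [Prod.fst_add, Prod.fst_sum]
    simp [monomialChar, vertexIndex, edgeIndex]
  · rw [Prod.snd_add, Prod.snd_sum]
    funext m
    have h : ∑ l, (a.2.1 l : ℤ) = d a.1 := by exact_mod_cast sum_exponents a.2
    simp only [Pi.add_apply, Finset.sum_apply, monomialChar, vertexIndex, edgeIndex, Prod.smul_snd,
      Prod.snd_sub, Pi.smul_apply, Pi.sub_apply, Finsupp.add_apply]
    simp only [nsmul_eq_mul, Nat.cast_add]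
    have : ∀ l, (a.2.1 l : ℤ) * ((Finsupp.single j (d i - 1) m : ℕ) + (Finsupp.single l 1 m : ℕ)
        - (Finsupp.single j (d i) m : ℕ)) = (if m = l then (a.2.1 l : ℤ) else 0)
          - (a.2.1 l : ℤ) * (if m = j then 1 else 0) := by
      intro l
      rw [Finsupp.single_apply, Finsupp.single_apply, Finsupp.single_apply]
      by_cases h1 : j = m <;> by_cases h2 : l = m
      · subst h1; subst h2; simp [Nat.cast_sub hdi]
      · subst h1; simp [h2, Ne.symm h2, Nat.cast_sub hdi]
      · subst h2; simp [h1, Ne.symm h1]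
      · simp [h1, h2, Ne.symm h1, Ne.symm h2]
    rw [Finset.sum_congr rfl fun l _ => this l, Finset.sum_sub_distrib, ← Finset.sum_mul, h,
      Finset.sum_ite_eq]
    by_cases hm : m = j
    · subst hm; simp
    · simp [hm]

/-- A torus point is in the image of the parametrization. -/
theorem torusPoint_eq_paramPoint (hc : 1 ≤ c) (hd : ∀ i, 1 ≤ d i)
    (t : TorusPoints K (charLattice d N)) :
    ∃ (y : Fin c → K) (z : Fin (N + 1) → K),
      (fun a => ((t (Multiplicative.ofAdd (monomialChar d a)) : Kˣ) : K)) = paramPoint d y z := by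
  let i : Fin c := ⟨0, hc⟩
  let v : MonomialIndex N d → Kˣ := fun a => t (Multiplicative.ofAdd (monomialChar d a))
  -- This choice normalises `z_0 = 1`.
  refine ⟨fun k => v (vertexIndex d k 0),
    fun l => (v (edgeIndex hd i 0 l) / v (vertexIndex d i 0) : Kˣ), funext fun a => ?_⟩
  rw [monomialChar_eq hd i 0 a]
  simp only [ofAdd_add, ofAdd_sum, ofAdd_nsmul, ofAdd_sub, map_mul, map_prod, map_pow, map_div,
    paramPoint, v]
  push_cast
  rfl

/-- The parametrization maps points with nonzero coordinates to torus points. -/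
theorem exists_torusPoint (y : Fin c → Kˣ) (z : Fin (N + 1) → Kˣ) :
    ∃ t : TorusPoints K (charLattice d N),
      (fun a => ((t (Multiplicative.ofAdd (monomialChar d a)) : Kˣ) : K)) =
        paramPoint d (fun i => (y i : K)) (fun j => (z j : K)) := by
  refine ⟨{ toFun := fun m => (∏ i, y i ^ (m.toAdd.1.1 i)) * ∏ j, z j ^ (m.toAdd.1.2 j)
            map_one' := by simp
            map_mul' := fun m m' => by
              simp only [toAdd_mul, AddSubgroup.coe_add, Prod.fst_add, Prod.snd_add, Pi.add_apply,
                zpow_add, Finset.prod_mul_distrib]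
              exact mul_mul_mul_comm _ _ _ _ }, funext fun a => ?_⟩
  simp only [MonoidHom.coe_mk, OneHom.coe_mk, toAdd_ofAdd, monomialChar, paramPoint]
  rw [Finset.prod_eq_single a.1]
  · simp
  · intro b _ hb
    simp [Pi.single_eq_of_ne hb]
  · simp

theorem vanishingIdeal_torus [Infinite K] (hc : 1 ≤ c) (hd : ∀ i, 1 ≤ d i) :
    MvPolynomial.vanishingIdeal K
      (Set.range fun (t : TorusPoints K (charLattice d N)) (a : MonomialIndex N d) =>
        ((t (Multiplicative.ofAdd (monomialChar d a)) : Kˣ) : K)) =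
      RingHom.ker (paramHom K N d) := by
  ext f
  rw [MvPolynomial.mem_vanishingIdeal_iff, RingHom.mem_ker]
  constructor
  · intro h
    -- The torus only controls points with nonzero coordinates. After multiplication by all the
    -- variables the polynomial vanishes everywhere, hence is zero as `K` is infinite.
    have hprod : (∏ s, MvPolynomial.X s) * paramHom K N d f = 0 := by
      apply MvPolynomial.funext
      intro p
      rw [map_mul, map_prod, map_zero]
      by_cases hp : ∀ s, p s ≠ 0
      · obtain ⟨t, ht⟩ := exists_torusPoint (d := d) (fun i => Units.mk0 _ (hp (Sum.inl i)))
          (fun j => Units.mk0 _ (hp (Sum.inr j)))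
        have h1 := h _ ⟨t, rfl⟩
        beta_reduce at h1
        rw [ht, aeval_paramPoint] at h1
        have h2 : (Sum.elim (fun i => ((Units.mk0 _ (hp (Sum.inl i)) : Kˣ) : K))
          (fun j => ((Units.mk0 _ (hp (Sum.inr j)) : Kˣ) : K))) = p := by
          ext s; cases s <;> rfl
        rw [h2] at h1
        have h3 : MvPolynomial.eval p (paramHom K N d f) = 0 := by
          rwa [← MvPolynomial.coe_aeval_eq_eval]
        rw [h3, mul_zero]
      · push Not at hp
        obtain ⟨s, hs⟩ := hp
        rw [Finset.prod_eq_zero (Finset.mem_univ s), zero_mul]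
        simpa using hs
    refine (mul_eq_zero.mp hprod).resolve_left ?_
    exact Finset.prod_ne_zero_iff.mpr fun s _ => MvPolynomial.X_ne_zero s
  · rintro h _ ⟨t, rfl⟩
    obtain ⟨y, z, hyz⟩ := torusPoint_eq_paramPoint hc hd t
    beta_reduce
    rw [hyz, aeval_paramPoint, h, map_zero]

theorem mem_affineToric_iff [Infinite K] (hc : 1 ≤ c) (hd : ∀ i, 1 ≤ d i)
    (w : MonomialIndex N d → K) :
    w ∈ affineToric K (monomialChar (N := N) d) ↔
      ∀ f ∈ RingHom.ker (paramHom K N d), MvPolynomial.aeval w f = 0 := by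
  rw [affineToric, vanishingIdeal_torus hc hd, MvPolynomial.mem_zeroLocus_iff]

theorem aeval_paramPoint_of_mem_ker {C : Type*} [CommRing C] [Algebra K C] (y : Fin c → C)
    (z : Fin (N + 1) → C) {f : MvPolynomial (MonomialIndex N d) K}
    (hf : f ∈ RingHom.ker (paramHom K N d)) :
    MvPolynomial.aeval (paramPoint d y z) f = 0 := by
  rw [aeval_paramPoint, (RingHom.mem_ker).mp hf, map_zero]

/-- If all vertex coordinates of a point of the toric variety vanish, then so does the point. -/
theorem exists_vertex_ne_zero (hd : ∀ i, 1 ≤ d i) (w : MonomialIndex N d → K)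
    (hw : ∀ f ∈ RingHom.ker (paramHom K N d), MvPolynomial.aeval w f = 0) (hw0 : w ≠ 0) :
    ∃ i j, w (vertexIndex d i j) ≠ 0 := by
  obtain ⟨a, ha⟩ := Function.ne_iff.mp hw0
  by_contra! hv
  -- Each coordinate is integral over the vertex coordinates: `(Y_i X^e)^{d_i} = ∏ (Y_i
  -- X_j^{d_i})^{e_j}`.
  have hmem : (MvPolynomial.X a ^ d a.1 - ∏ j, MvPolynomial.X (vertexIndex d a.1 j) ^ a.2.1 j :
      MvPolynomial _ K) ∈ RingHom.ker (paramHom K N d) := by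
    rw [RingHom.mem_ker]
    simp only [map_sub, map_pow, map_prod, paramHom, MvPolynomial.aeval_X,
      paramPoint_vertexIndex]
    rw [prod_mul_pow_exponents]
    simp only [paramPoint, mul_pow, ← Finset.prod_pow, ← pow_mul, mul_comm, sub_self]
  have h := hw _ hmem
  simp only [map_sub, map_pow, map_prod, MvPolynomial.aeval_X, hv] at h
  obtain ⟨j, -, hj⟩ : ∃ j ∈ Finset.univ, a.2.1 j ≠ 0 := by
    apply Finset.exists_ne_zero_of_sum_ne_zero
    rw [sum_exponents]
    have := hd a.1
    omega
  rw [Finset.prod_eq_zero (Finset.mem_univ j) (zero_pow hj), sub_zero] at h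
  exact ha (pow_eq_zero_iff (by have := hd a.1; omega) |>.mp h)

theorem exists_eq_paramPoint (hd : ∀ i, 1 ≤ d i) (w : MonomialIndex N d → K)
    (hw : ∀ f ∈ RingHom.ker (paramHom K N d), MvPolynomial.aeval w f = 0) (hw0 : w ≠ 0) :
    ∃ (y : Fin c → K) (z : Fin (N + 1) → K), y ≠ 0 ∧ z ≠ 0 ∧ w = paramPoint d y z := by
  obtain ⟨i, j, hij⟩ := exists_vertex_ne_zero hd w hw hw0
  refine ⟨_, _, ?_, ?_, eq_paramPoint hd w hw i j _ (mul_inv_cancel₀ hij) 1 1 (mul_one 1)⟩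
  · exact Function.ne_iff.mpr ⟨i, by simpa using hij⟩
  · refine Function.ne_iff.mpr ⟨j, ?_⟩
    have : edgeIndex hd i j j = vertexIndex d i j := by
      have := hd i
      simp only [edgeIndex, vertexIndex, Sigma.mk.injEq, heq_eq_eq, true_and, Subtype.mk.injEq]
      rw [← Finsupp.single_add, Nat.sub_add_cancel this]
    simp [this, hij]

theorem smul_paramPoint {C : Type*} [CommRing C] (r : C) (y : Fin c → C) (z : Fin (N + 1) → C) :
    r • paramPoint d y z = paramPoint d (r • y) z := by
  funext a
  simp [paramPoint, mul_assoc]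

theorem smul_mem_affineToric [Infinite K] (hc : 1 ≤ c) (hd : ∀ i, 1 ≤ d i) (r : K)
    {w : MonomialIndex N d → K} (hw : w ∈ affineToric K (monomialChar (N := N) d)) :
    r • w ∈ affineToric K (monomialChar (N := N) d) := by
  rw [mem_affineToric_iff hc hd] at hw ⊢
  by_cases hw0 : w = 0
  · simpa [hw0] using hw
  · obtain ⟨y, z, -, -, rfl⟩ := exists_eq_paramPoint hd w hw hw0
    rw [smul_paramPoint]
    exact fun f hf => aeval_paramPoint_of_mem_ker _ _ hf

theorem affineCone_projToric [Infinite K] (hc : 1 ≤ c) (hd : ∀ i, 1 ≤ d i) :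
    affineCone (projToric K (monomialChar (N := N) d)) =
      affineToric K (monomialChar (N := N) d) := by
  ext w
  constructor
  · intro h
    by_cases hw0 : w = 0
    · rw [hw0, mem_affineToric_iff hc hd]
      have : (0 : MonomialIndex N d → K) = paramPoint d 0 0 := by
        funext a
        simp [paramPoint]
      rw [this]
      exact fun f hf => aeval_paramPoint_of_mem_ker _ _ hf
    · obtain ⟨r, hr⟩ := Projectivization.exists_smul_eq_mk_rep K w hw0
      have h1 : (Projectivization.mk K w hw0).rep ∈ affineToric K (monomialChar (N := N) d) := h hw0
      have h2 := smul_mem_affineToric hc hd (r⁻¹ : Kˣ).1 h1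
      rw [← hr] at h2
      simpa [Units.smul_def, smul_smul] using h2
  · intro h hw0
    obtain ⟨r, hr⟩ := Projectivization.exists_smul_eq_mk_rep K w hw0
    change (Projectivization.mk K w hw0).rep ∈ affineToric K (monomialChar (N := N) d)
    rw [← hr]
    exact smul_mem_affineToric hc hd r.1 h

/-- Smoothness and tangency are defined through the ideal of the cone; this makes them statements
about the kernel of the parametrization. -/
theorem coneIdeal_projToric [Infinite K] (hc : 1 ≤ c) (hd : ∀ i, 1 ≤ d i) :
    coneIdeal (projToric K (monomialChar (N := N) d)) = RingHom.ker (paramHom K N d) := by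
  rw [coneIdeal, affineCone_projToric hc hd, affineToric]
  refine Eq.trans ?_ (vanishingIdeal_torus hc hd)
  exact MvPolynomial.zeroLocus_vanishingIdeal_galoisConnection.u_l_u_eq_u _

end ToricIdeal

/-! ### First-order Taylor expansion over the dual numbers. -/

section DualNumbers

variable {K σ : Type*} [Field K]

theorem fst_aeval_dualNumber (W : σ → DualNumber K) (f : MvPolynomial σ K) :
    (MvPolynomial.aeval W f).fst = MvPolynomial.eval (fun a => (W a).fst) f := by
  induction f using MvPolynomial.induction_on with
  | C r => simp [TrivSqZeroExt.algebraMap_eq_inl]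
  | add p q hp hq => simp [hp, hq]
  | mul_X p a hp => simp [hp]

theorem snd_aeval_dualNumber [Fintype σ] (W : σ → DualNumber K) (f : MvPolynomial σ K) :
    (MvPolynomial.aeval W f).snd =
      ∑ a, MvPolynomial.eval (fun a => (W a).fst) (MvPolynomial.pderiv a f) * (W a).snd := by
  classical
  induction f using MvPolynomial.induction_on with
  | C r => simp [TrivSqZeroExt.algebraMap_eq_inl]
  | add p q hp hq => simp [hp, hq, add_mul, Finset.sum_add_distrib]
  | mul_X p b hp =>
    simp only [map_mul, MvPolynomial.aeval_X, TrivSqZeroExt.snd_mul, hp, fst_aeval_dualNumber,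
      Derivation.leibniz, MvPolynomial.pderiv_X, smul_eq_mul, map_add, MvPolynomial.eval_X,
      add_mul, Finset.sum_add_distrib]
    simp [Pi.single_apply, Finset.mul_sum, mul_comm, mul_left_comm]

end DualNumbers

/-! ### Tangent hyperplanes and singular tuples of forms. -/

section Tangent

variable {c N : ℕ} {d : Fin c → ℕ} {K : Type*} [Field K]

/-- At the point `z`, the forms `F_i` vanish and their differentials satisfy the linear relation
with coefficients `y_i`. -/
def IsSingularAt (F : FormTuple K N d) (y : Fin c → K) (z : Fin (N + 1) → K) : Prop :=
  (∀ i, MvPolynomial.eval z (F i : MvPolynomial (Fin (N + 1)) K) = 0) ∧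
    ∀ j, ∑ i, y i * MvPolynomial.eval z (MvPolynomial.pderiv j
      (F i : MvPolynomial (Fin (N + 1)) K)) = 0

theorem IsSingularAt.smul_form {F : FormTuple K N d} {y : Fin c → K} {z : Fin (N + 1) → K}
    (h : IsSingularAt F y z) (r : K) : IsSingularAt (r • F) y z := by
  refine ⟨fun i => by simp [h.1 i], fun j => ?_⟩
  have := congrArg (r * ·) (h.2 j)
  simp only [Finset.mul_sum, mul_zero] at this
  rw [← this]
  exact Finset.sum_congr rfl fun i _ => by simp; ring

theorem IsSingularAt.smul_left {F : FormTuple K N d} {y : Fin c → K} {z : Fin (N + 1) → K}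
    (h : IsSingularAt F y z) (r : K) : IsSingularAt F (r • y) z := by
  refine ⟨h.1, fun j => ?_⟩
  have := congrArg (r * ·) (h.2 j)
  simp only [Finset.mul_sum, mul_zero] at this
  rw [← this]
  exact Finset.sum_congr rfl fun i _ => by simp; ring

/-- Allowing values in any algebra `C` matters: over the dual numbers the `ε`-part of this identity
compares differentials. -/
theorem sum_coeffEquiv_mul_paramPoint {C : Type*} [CommRing C] [Algebra K C]
    (F : FormTuple K N d) (y : Fin c → C) (z : Fin (N + 1) → C) :
    ∑ a, algebraMap K C (coeffEquiv K N d F a) * paramPoint d y z a =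
      ∑ i, y i * MvPolynomial.aeval z (F i : MvPolynomial (Fin (N + 1)) K) := by
  rw [Fintype.sum_sigma]
  refine Finset.sum_congr rfl fun i _ => ?_
  have h : (F i : MvPolynomial (Fin (N + 1)) K) =
      ∑ e : {e : Fin (N + 1) →₀ ℕ // e.degree = d i},
        MvPolynomial.monomial e.1 (coeffEquiv K N d F ⟨i, e⟩) :=
    congrArg (fun G : FormTuple K N d => (G i : MvPolynomial (Fin (N + 1)) K))
      ((coeffEquiv K N d).left_inv F).symm
  conv_rhs => rw [h, map_sum, Finset.mul_sum]
  refine Finset.sum_congr rfl fun e _ => ?_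
  rw [MvPolynomial.aeval_monomial, Finsupp.prod_fintype _ _ (fun _ => pow_zero _)]
  simp only [paramPoint]
  ring

theorem fst_paramPoint (y η : Fin c → K) (z ξ : Fin (N + 1) → K) (a : MonomialIndex N d) :
    (paramPoint d (fun i => (TrivSqZeroExt.inl (y i) + TrivSqZeroExt.inr (η i) : DualNumber K))
      (fun j => TrivSqZeroExt.inl (z j) + TrivSqZeroExt.inr (ξ j)) a).fst = paramPoint d y z a := by
  have := map_prod (TrivSqZeroExt.fstHom K K K)
    (fun j => (TrivSqZeroExt.inl (z j) + TrivSqZeroExt.inr (ξ j) : DualNumber K) ^ a.2.1 j)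
    Finset.univ
  simp only [TrivSqZeroExt.fstHom_apply] at this
  simp only [paramPoint, TrivSqZeroExt.fst_mul, this, TrivSqZeroExt.fst_pow, TrivSqZeroExt.fst_add,
    TrivSqZeroExt.fst_inl, TrivSqZeroExt.fst_inr, add_zero]

theorem snd_sum_mul_aeval (F : FormTuple K N d) (Y : Fin c → DualNumber K)
    (Z : Fin (N + 1) → DualNumber K) :
    (∑ i, Y i * MvPolynomial.aeval Z (F i : MvPolynomial (Fin (N + 1)) K)).snd =
      (∑ i, (Y i).snd * MvPolynomial.eval (fun j => (Z j).fst) (F i).1) +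
        ∑ j, (∑ i, (Y i).fst * MvPolynomial.eval (fun j => (Z j).fst)
          (MvPolynomial.pderiv j (F i).1)) * (Z j).snd := by
  have := map_sum (TrivSqZeroExt.sndHom K K)
    (fun i => Y i * MvPolynomial.aeval Z (F i : MvPolynomial (Fin (N + 1)) K)) Finset.univ
  simp only [TrivSqZeroExt.sndHom_apply] at this
  rw [this]
  simp only [TrivSqZeroExt.snd_mul, fst_aeval_dualNumber, snd_aeval_dualNumber, smul_eq_mul,
    Finset.sum_add_distrib, Finset.sum_mul, Finset.mul_sum]
  rw [add_comm, Finset.sum_comm]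
  congr 1
  exact Finset.sum_congr rfl fun i _ => Finset.sum_congr rfl fun i _ => by ring

/-- Tangent vectors become points of the cone with values in the dual numbers, to which
`eq_paramPoint` applies. -/
theorem mem_coneTangentSpace_iff {X : Set (ℙ K (MonomialIndex N d → K))}
    {x : ℙ K (MonomialIndex N d → K)} {W : MonomialIndex N d → DualNumber K}
    (hW : ∀ a, (W a).fst = x.rep a) (hx : ∀ f ∈ coneIdeal X, MvPolynomial.eval x.rep f = 0) :
    (fun a => (W a).snd) ∈ coneTangentSpace X x ↔
      ∀ f ∈ coneIdeal X, MvPolynomial.aeval W f = 0 := by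
  have hW' : (fun a => (W a).fst) = x.rep := funext hW
  constructor
  · intro h f hf
    apply TrivSqZeroExt.ext
    · rw [fst_aeval_dualNumber, hW', hx f hf, TrivSqZeroExt.fst_zero]
    · rw [snd_aeval_dualNumber, hW', TrivSqZeroExt.snd_zero]
      exact h f hf
  · intro h f hf
    have := congrArg TrivSqZeroExt.snd (h f hf)
    rwa [snd_aeval_dualNumber, hW', TrivSqZeroExt.snd_zero] at this

variable [Infinite K] (hc : 1 ≤ c) (hd : ∀ i, 1 ≤ d i)

include hc hd in
/-- A hyperplane tangent to the toric variety at `y_i z^e` corresponds to a tuple of forms that is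
singular at `z`. -/
theorem isSingularAt_of_tangent (F : FormTuple K N d) {x : ℙ K (MonomialIndex N d → K)}
    {y : Fin c → K} {z : Fin (N + 1) → K} (hx : x.rep = paramPoint d y z)
    (h : ∀ v ∈ coneTangentSpace (projToric K (monomialChar (N := N) d)) x,
      ∑ a, coeffEquiv K N d F a * v a = 0) : IsSingularAt F y z := by
  -- The left side is the differential of `∑ Y_i F_i` at `(y, z)` in the direction `(η, ξ)`. The
  -- parametrization carries this direction to a tangent vector, which the hyperplane contains.
  have key : ∀ (η : Fin c → K) (ξ : Fin (N + 1) → K),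
      (∑ i, η i * MvPolynomial.eval z (F i).1) +
        ∑ j, (∑ i, y i * MvPolynomial.eval z (MvPolynomial.pderiv j (F i).1)) * ξ j = 0 := by
    intro η ξ
    let Y : Fin c → DualNumber K := fun i => TrivSqZeroExt.inl (y i) + TrivSqZeroExt.inr (η i)
    let Z : Fin (N + 1) → DualNumber K :=
      fun j => TrivSqZeroExt.inl (z j) + TrivSqZeroExt.inr (ξ j)
    have h1 : (fun a => (paramPoint d Y Z a).snd) ∈
        coneTangentSpace (projToric K (monomialChar (N := N) d)) x := by
      rw [mem_coneTangentSpace_iff]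
      · rw [coneIdeal_projToric hc hd]
        exact fun f hf => aeval_paramPoint_of_mem_ker _ _ hf
      · intro a
        rw [hx]
        exact fst_paramPoint y η z ξ a
      · rw [coneIdeal_projToric hc hd, hx]
        intro f hf
        rw [← MvPolynomial.coe_aeval_eq_eval]
        exact aeval_paramPoint_of_mem_ker _ _ hf
    have h2 := congrArg TrivSqZeroExt.snd (sum_coeffEquiv_mul_paramPoint F Y Z)
    rw [snd_sum_mul_aeval] at h2
    have h3 := map_sum (TrivSqZeroExt.sndHom K K)
      (fun a => algebraMap K (DualNumber K) (coeffEquiv K N d F a) * paramPoint d Y Z a)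
      Finset.univ
    simp only [TrivSqZeroExt.sndHom_apply] at h3
    have h4 := h _ h1
    rw [h3] at h2
    simp only [TrivSqZeroExt.algebraMap_eq_inl, TrivSqZeroExt.snd_mul, TrivSqZeroExt.fst_inl,
      TrivSqZeroExt.snd_inl, smul_zero, add_zero, smul_eq_mul] at h2
    rw [h4] at h2
    simpa [Y, Z] using h2.symm
  constructor
  · intro i
    simpa [Pi.single_apply] using key (Pi.single i 1) 0
  · intro j
    simpa [Pi.single_apply] using key 0 (Pi.single j 1)

-- Every tangent vector lifts to a deformation of `(y, z)`: the vertex coordinate is nonzero at the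
-- base point, so invertible over the dual numbers, and `eq_paramPoint` yields the lift. Along it
-- the differential of `∑ Y_i F_i` vanishes.
include hc hd in
theorem tangent_of_isSingularAt (F : FormTuple K N d) {x : ℙ K (MonomialIndex N d → K)}
    {y : Fin c → K} {z : Fin (N + 1) → K} (hx : x.rep = paramPoint d y z) (hy : y ≠ 0)
    (hz : z ≠ 0) (h : IsSingularAt F y z) :
    ∀ v ∈ coneTangentSpace (projToric K (monomialChar (N := N) d)) x,
      ∑ a, coeffEquiv K N d F a * v a = 0 := by
  intro v hv
  obtain ⟨i, hi⟩ := Function.ne_iff.mp hy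
  obtain ⟨j, hj⟩ := Function.ne_iff.mp hz
  simp only [Pi.zero_apply] at hi hj
  let W : MonomialIndex N d → DualNumber K :=
    fun a => TrivSqZeroExt.inl (x.rep a) + TrivSqZeroExt.inr (v a)
  have hWfst : ∀ a, (W a).fst = x.rep a := fun a => by simp [W]
  have hWsnd : (fun a => (W a).snd) = v := by
    funext a
    simp [W]
  have hW : ∀ f ∈ RingHom.ker (paramHom K N d), MvPolynomial.aeval W f = 0 := by
    rw [← coneIdeal_projToric hc hd, ← mem_coneTangentSpace_iff hWfst, hWsnd]
    · exact hv
    · rw [coneIdeal_projToric hc hd, hx]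
      intro f hf
      rw [← MvPolynomial.coe_aeval_eq_eval]
      exact aeval_paramPoint_of_mem_ker _ _ hf
  have hunit : IsUnit (W (vertexIndex d i j)) := by
    rw [TrivSqZeroExt.isUnit_iff_isUnit_fst, hWfst, hx, paramPoint_vertexIndex, isUnit_iff_ne_zero]
    exact mul_ne_zero hi (pow_ne_zero _ hj)
  obtain ⟨t, ht⟩ := hunit.exists_right_inv
  have hfst : (W (vertexIndex d i j)).fst * t.fst = 1 := by
    rw [← TrivSqZeroExt.fst_mul, ht, TrivSqZeroExt.fst_one]
  -- The scaling factor `u = z_j` makes the lift reduce to the given `(y, z)` instead of the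
  -- representative with `z_j = 1`.
  have heq := eq_paramPoint hd W hW i j t ht (TrivSqZeroExt.inl (z j))
    (TrivSqZeroExt.inl (z j)⁻¹) (by rw [← TrivSqZeroExt.inl_mul, mul_inv_cancel₀ hj]; rfl)
  set Y : Fin c → DualNumber K :=
    fun k => TrivSqZeroExt.inl (z j)⁻¹ ^ d k * W (vertexIndex d k j) with hY
  set Z : Fin (N + 1) → DualNumber K :=
    fun l => TrivSqZeroExt.inl (z j) * (t * W (edgeIndex hd i j l)) with hZ
  have hYfst : ∀ k, (Y k).fst = y k := by
    intro k
    simp only [hY, TrivSqZeroExt.fst_mul, TrivSqZeroExt.fst_pow, TrivSqZeroExt.fst_inl, hWfst, hx,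
      paramPoint_vertexIndex, inv_pow]
    field_simp
  have hZfst : (fun l => (Z l).fst) = z := by
    funext l
    have h1 : t.fst = (y i * z j ^ d i)⁻¹ := by
      rw [hWfst, hx, paramPoint_vertexIndex] at hfst
      exact eq_inv_of_mul_eq_one_right hfst
    simp only [hZ, TrivSqZeroExt.fst_mul, TrivSqZeroExt.fst_inl, hWfst, hx, h1,
      paramPoint_edgeIndex]
    obtain ⟨n, hn⟩ := Nat.exists_eq_add_of_le' (hd i)
    rw [hn, Nat.add_sub_cancel]
    field_simp
    ring
  have h2 := congrArg TrivSqZeroExt.snd (sum_coeffEquiv_mul_paramPoint F Y Z)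
  rw [snd_sum_mul_aeval, hZfst, ← heq] at h2
  simp only [hYfst, h.1, h.2, mul_zero, zero_mul, Finset.sum_const_zero, add_zero] at h2
  have h3 := map_sum (TrivSqZeroExt.sndHom K K)
    (fun a => algebraMap K (DualNumber K) (coeffEquiv K N d F a) * W a) Finset.univ
  simp only [TrivSqZeroExt.sndHom_apply] at h3
  rw [h3] at h2
  simpa [TrivSqZeroExt.algebraMap_eq_inl, W] using h2

end Tangent

/-! ### Smoothness of the toric variety. -/

section Smooth

/-- To lift a map out of `A`, lift its composite with `r` and restrict the result along `s`. -/
theorem formallySmooth_of_retract {R A S : Type*} [CommRing R] [CommRing A] [CommRing S]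
    [Algebra R A] [Algebra R S] [Algebra.FormallySmooth R S] (s : A →ₐ[R] S) (r : S →ₐ[R] A)
    (h : r.comp s = AlgHom.id R A) : Algebra.FormallySmooth R A := by
  refine Algebra.FormallySmooth.of_comp_surjective fun B _ _ I hI f => ?_
  obtain ⟨g, hg⟩ := Algebra.FormallySmooth.exists_lift I ⟨2, hI⟩ (f.comp r)
  refine ⟨g.comp s, ?_⟩
  rw [← AlgHom.comp_assoc, hg, AlgHom.comp_assoc, h, AlgHom.comp_id]

variable {c N : ℕ} {d : Fin c → ℕ} {K : Type*} [Field K]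

/-- The coordinate ring of the toric variety is smooth where a vertex coordinate is invertible. -/
theorem formallySmooth_localization (hd : ∀ i, 1 ≤ d i) (i : Fin c) (j : Fin (N + 1)) :
    Algebra.FormallySmooth K (Localization.Away (Ideal.Quotient.mk (RingHom.ker (paramHom K N d))
      (MvPolynomial.X (vertexIndex d i j)))) := by
  set I := RingHom.ker (paramHom K N d)
  set w₀ : MvPolynomial (MonomialIndex N d) K ⧸ I :=
    Ideal.Quotient.mk I (MvPolynomial.X (vertexIndex d i j)) with hw₀
  set p₀ : MvPolynomial (Fin c ⊕ Fin (N + 1)) K :=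
    MvPolynomial.X (Sum.inl i) * MvPolynomial.X (Sum.inr j) ^ d i with hp₀
  let A := Localization.Away w₀
  let W : MonomialIndex N d → A :=
    fun a => algebraMap _ A (Ideal.Quotient.mk I (MvPolynomial.X a))
  have haeval : ∀ f : MvPolynomial (MonomialIndex N d) K,
      MvPolynomial.aeval W f = algebraMap _ A (Ideal.Quotient.mk I f) := by
    intro f
    have : (MvPolynomial.aeval W : MvPolynomial (MonomialIndex N d) K →ₐ[K] A) =
        (IsScalarTower.toAlgHom K (MvPolynomial (MonomialIndex N d) K ⧸ I) A).comp
          (Ideal.Quotient.mkₐ K I) := by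
      ext a
      simp [W]
    rw [this]
    rfl
  have hW : ∀ f ∈ I, MvPolynomial.aeval W f = 0 := by
    intro f hf
    rw [haeval, Ideal.Quotient.eq_zero_iff_mem.mpr hf, map_zero]
  have ht : W (vertexIndex d i j) * IsLocalization.Away.invSelf w₀ = 1 :=
    IsLocalization.Away.mul_invSelf w₀
  have heq := eq_paramPoint hd W hW i j _ ht 1 1 (mul_one 1)
  set Y : Fin c → A := fun k => 1 ^ d k * W (vertexIndex d k j)
  set Z : Fin (N + 1) → A := fun l => 1 * (IsLocalization.Away.invSelf w₀ * W (edgeIndex hd i j l))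
  -- The parametrization embeds the ring into a localized polynomial ring, which is formally smooth;
  -- `r` below, given by the formulas of `eq_paramPoint`, retracts it.
  let s' : MvPolynomial (MonomialIndex N d) K ⧸ I →ₐ[K] Localization.Away p₀ :=
    Ideal.Quotient.liftₐ I ((IsScalarTower.toAlgHom K _ (Localization.Away p₀)).comp
      (paramHom K N d)) fun f hf => by
        rw [AlgHom.comp_apply, (RingHom.mem_ker).mp hf, map_zero]
  have hs' : ∀ a, s' (Ideal.Quotient.mk I (MvPolynomial.X a)) =
      algebraMap _ (Localization.Away p₀) (paramHom K N d (MvPolynomial.X a)) := fun a => rfl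
  have hparam : paramHom K N d (MvPolynomial.X (vertexIndex d i j)) = p₀ := by
    rw [paramHom, MvPolynomial.aeval_X, paramPoint_vertexIndex]
  let s : A →ₐ[K] Localization.Away p₀ := IsLocalization.liftAlgHom (M := .powers w₀) (f := s') <| by
    rintro ⟨_, n, rfl⟩
    rw [map_pow, hw₀, hs', hparam]
    exact (IsLocalization.Away.algebraMap_isUnit p₀).pow n
  let r' : MvPolynomial (Fin c ⊕ Fin (N + 1)) K →ₐ[K] A := MvPolynomial.aeval (Sum.elim Y Z)
  have hr' : ∀ f, r' (paramHom K N d f) = MvPolynomial.aeval W f := by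
    intro f
    rw [heq, aeval_paramPoint]
  let r : Localization.Away p₀ →ₐ[K] A := IsLocalization.liftAlgHom (M := .powers p₀) (f := r') <| by
    rintro ⟨_, n, rfl⟩
    rw [map_pow, ← hparam, hr', MvPolynomial.aeval_X]
    exact (IsUnit.of_mul_eq_one _ ht).pow n
  have : Algebra.FormallySmooth K (Localization.Away p₀) := inferInstance
  refine formallySmooth_of_retract s r ?_
  apply IsLocalization.algHom_ext (.powers w₀)
  apply Ideal.Quotient.algHom_ext
  ext a
  change r (s (algebraMap _ A (Ideal.Quotient.mk I (MvPolynomial.X a)))) = W a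
  simp only [s, IsLocalization.liftAlgHom_apply, IsLocalization.lift_eq]
  change r (s' (Ideal.Quotient.mk I (MvPolynomial.X a))) = W a
  rw [hs']
  simp only [r, IsLocalization.liftAlgHom_apply, IsLocalization.lift_eq]
  change r' _ = W a
  rw [hr', MvPolynomial.aeval_X]

theorem isSmoothPoint_projToric [Infinite K] (hc : 1 ≤ c) (hd : ∀ i, 1 ≤ d i)
    {x : ℙ K (MonomialIndex N d → K)} (hx : x ∈ projToric K (monomialChar (N := N) d)) :
    IsSmoothPoint (projToric K (monomialChar (N := N) d)) x := by
  have hx' : ∀ f ∈ RingHom.ker (paramHom K N d), MvPolynomial.aeval x.rep f = 0 :=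
    (mem_affineToric_iff hc hd _).mp hx
  obtain ⟨i, j, hij⟩ := exists_vertex_ne_zero hd x.rep hx' x.rep_nonzero
  -- With a variable ideal `J` the equality of ideals can be substituted, so no transport between
  -- quotient rings is needed.
  suffices key : ∀ J, J = RingHom.ker (paramHom K N d) →
      ∃ p ∈ Algebra.smoothLocus K (MvPolynomial (MonomialIndex N d) K ⧸ J),
        PrimeSpectrum.comap (Ideal.Quotient.mk J) p = MvPolynomial.pointToPoint x.rep from
    key _ (coneIdeal_projToric hc hd)
  rintro _ rfl
  set I := RingHom.ker (paramHom K N d)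
  have hle : RingHom.ker (Ideal.Quotient.mk I) ≤
      (MvPolynomial.pointToPoint (k := K) x.rep).asIdeal := by
    rw [Ideal.mk_ker]
    exact fun f hf => (MvPolynomial.mem_vanishingIdeal_singleton_iff _ _).mpr (hx' f hf)
  obtain ⟨p, hp⟩ : MvPolynomial.pointToPoint (k := K) x.rep ∈
      Set.range (PrimeSpectrum.comap (Ideal.Quotient.mk I)) := by
    rw [range_comap_of_surjective _ _ Ideal.Quotient.mk_surjective]
    exact hle
  refine ⟨p, ?_, hp⟩
  have : Algebra.FinitePresentation K (MvPolynomial (MonomialIndex N d) K ⧸ I) :=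
    Algebra.FinitePresentation.of_finiteType.mp inferInstance
  refine Algebra.basicOpen_subset_smoothLocus_iff.mpr (formallySmooth_localization hd i j) ?_
  intro hmem
  have h1 : MvPolynomial.X (vertexIndex d i j) ∈
      (PrimeSpectrum.comap (Ideal.Quotient.mk I) p).asIdeal := hmem
  rw [hp] at h1
  have h2 := (MvPolynomial.mem_vanishingIdeal_singleton_iff _ _).mp h1
  rw [MvPolynomial.aeval_X] at h2
  exact hij h2

end Smooth

/-! ### Elimination theory by Macaulay matrices. -/

section Elimination

/-- If no nonzero functional kills all the vectors `v u`, some of them form an invertible square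
matrix. -/
theorem exists_det_ne_zero {K U W : Type*} [Field K] [Fintype W] [DecidableEq W] (v : U → W → K)
    (h : ∀ y : W → K, (∀ u, ∑ m, y m * v u m = 0) → y = 0) :
    ∃ s : W → U, Function.Injective s ∧ (Matrix.of fun m => v (s m)).det ≠ 0 := by
  have hspan : Submodule.span K (Set.range v) = ⊤ := by
    by_contra hne
    obtain ⟨f, hf, hle⟩ := Submodule.exists_le_ker_of_lt_top _ (lt_top_iff_ne_top.mpr hne)
    have hfv : ∀ w : W → K, f w = ∑ m, f (Pi.single m 1) * w m := by
      intro w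
      conv_lhs => rw [pi_eq_sum_univ' w, map_sum]
      refine Finset.sum_congr rfl fun m _ => ?_
      rw [map_smul, smul_eq_mul, mul_comm]
    have h0 := h (fun m => f (Pi.single m 1)) fun u => by
      rw [← hfv]
      exact hle (Submodule.subset_span ⟨u, rfl⟩)
    apply hf
    ext w
    simp [congrFun h0 w]
  obtain ⟨κ, a, ha, hsp, hli⟩ := exists_linearIndependent' K v
  let b : Module.Basis κ K (W → K) := Module.Basis.mk hli (by rw [hsp, hspan])
  let e : W ≃ κ := (Pi.basisFun K W).indexEquiv b
  refine ⟨a ∘ e, ha.comp e.injective, ?_⟩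
  rw [← isUnit_iff_ne_zero, ← Matrix.isUnit_iff_isUnit_det,
    ← Matrix.linearIndependent_rows_iff_isUnit]
  exact hli.comp e e.injective

open MvPolynomial in
/-- Elimination theory: for a weighted homogeneous system whose coefficients are linear forms in
parameters `v`, if the ideal of the system contains all monomials of weight `t`, then some
homogeneous polynomial in the parameters is nonzero at `v` and vanishes at all parameters for which
there is a solution with a nonvanishing monomial of weight `t`. -/
theorem exists_resultant {K σ A G M : Type*} [Field K] [Fintype A] [AddCommMonoid M]
    (wt : σ → M) (t : M) (hfin : {m : σ →₀ ℕ | Finsupp.weight wt m = t}.Finite)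
    (g : G → (A → K) →ₗ[K] MvPolynomial σ K) (n : G → M)
    (hg : ∀ i v, IsWeightedHomogeneous wt (g i v) (n i)) (v : A → K)
    (hv : ∀ m, Finsupp.weight wt m = t → monomial m 1 ∈ Ideal.span (Set.range fun i => g i v)) :
    ∃ (k : ℕ) (f : MvPolynomial A K), f.IsHomogeneous k ∧ eval v f ≠ 0 ∧
      ∀ (v' : A → K) (p : σ → K), (∀ i, eval p (g i v') = 0) →
        (∃ m, Finsupp.weight wt m = t ∧ eval p (monomial m 1) ≠ 0) → eval v' f = 0 := by
  classical
  let W := {m : σ →₀ ℕ // Finsupp.weight wt m = t}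
  have : Finite W := hfin
  let : Fintype W := Fintype.ofFinite W
  -- The Macaulay matrix: the row of `(i, m)` lists the coefficients of `X^m g_i` at the monomials
  -- of weight `t`. A product of another weight gives a zero row.
  let L : G × (σ →₀ ℕ) → W → (A → K) →ₗ[K] K := fun u m =>
    if Finsupp.weight wt u.2 + n u.1 = t then
      (lcoeff K m.1) ∘ₗ (LinearMap.mulLeft K (monomial u.2 1)) ∘ₗ g u.1 else 0
  have hhom : ∀ (u : G × (σ →₀ ℕ)) w, IsWeightedHomogeneous wt (monomial u.2 1 * g u.1 w)
      (Finsupp.weight wt u.2 + n u.1) := fun u w =>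
    (isWeightedHomogeneous_monomial wt u.2 1 rfl).mul (hg u.1 w)
  have hL : ∀ u m w, L u m w = coeff m.1 (monomial u.2 1 * g u.1 w) := by
    intro u m w
    by_cases hu : Finsupp.weight wt u.2 + n u.1 = t
    · simp [L, hu]
    · rw [(hhom u w).coeff_eq_zero _ fun h => hu (h.symm.trans m.2)]
      simp [L, hu]
  have hrows : ∀ y : W → K, (∀ u, ∑ m, y m * L u m v = 0) → y = 0 := by
    intro y hy
    -- The vector `y` is read as a functional vanishing off weight `t`. It kills all multiples of
    -- the generators, hence the ideal, hence every monomial of weight `t`.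
    let Λ : MvPolynomial σ K →ₗ[K] K := ∑ m : W, y m • lcoeff K m.1
    have hΛ : ∀ q, Λ q = ∑ m, y m * coeff m.1 q := fun q => by simp [Λ]
    have hgen : ∀ (i : G) (r : MvPolynomial σ K), Λ (r * g i v) = 0 := by
      intro i r
      rw [as_sum r, Finset.sum_mul, map_sum]
      refine Finset.sum_eq_zero fun m _ => ?_
      have hm : monomial m (coeff m r) = coeff m r • monomial m (1 : K) := by
        rw [smul_monomial, smul_eq_mul, mul_one]
      rw [hm, smul_mul_assoc, map_smul, hΛ]
      have := hy (i, m)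
      simp only [hL] at this
      rw [this, smul_zero]
    have hker : ∀ q ∈ Ideal.span (Set.range fun i => g i v), ∀ r, Λ (r * q) = 0 := by
      intro q hq
      induction hq using Submodule.span_induction with
      | mem q hq =>
        obtain ⟨i, rfl⟩ := hq
        exact hgen i
      | zero => simp
      | add p q _ _ hp hq => intro r; rw [mul_add, map_add, hp, hq, add_zero]
      | smul a q _ hq => intro r; rw [smul_eq_mul, ← mul_assoc, hq]
    funext m
    have := hker _ (hv m.1 m.2) 1
    rw [one_mul, hΛ, Finset.sum_eq_single m] at this
    · simpa using this
    · intro b _ hb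
      rw [coeff_monomial, if_neg fun h => hb (Subtype.ext h.symm), mul_zero]
    · simp
  obtain ⟨s, -, hs⟩ := exists_det_ne_zero (fun u m => L u m v) hrows
  let Lp : W → W → MvPolynomial A K := fun m m' => ∑ a, C (L (s m) m' (Pi.single a 1)) * X a
  have heval : ∀ w m m', eval w (Lp m m') = L (s m) m' w := by
    intro w m m'
    simp only [Lp, map_sum, map_mul, eval_C, eval_X]
    conv_rhs => rw [pi_eq_sum_univ' w, map_sum]
    refine Finset.sum_congr rfl fun a _ => ?_
    rw [map_smul, smul_eq_mul, mul_comm]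
  have hdet : ∀ w, eval w (Matrix.of Lp).det = (Matrix.of fun m m' => L (s m) m' w).det := by
    intro w
    rw [RingHom.map_det]
    congr 1
    ext m m'
    exact heval w m m'
  refine ⟨Fintype.card W, (Matrix.of Lp).det, ?_, ?_, ?_⟩
  · rw [Matrix.det_apply]
    refine IsHomogeneous.sum _ _ _ fun τ _ => ?_
    rw [Units.smul_def, zsmul_eq_mul]
    have h1 : IsHomogeneous (∏ m, Matrix.of Lp (τ m) m) (∑ _m : W, 1) :=
      IsHomogeneous.prod _ _ _ fun m _ => IsHomogeneous.sum _ _ _ fun a _ => by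
        simpa using (isHomogeneous_C A _).mul (isHomogeneous_X K a)
    rw [Finset.sum_const, smul_eq_mul, mul_one] at h1
    have h2 := (isHomogeneous_C A (((Equiv.Perm.sign τ : ℤˣ) : ℤ) : K)).mul h1
    rw [zero_add, map_intCast] at h2
    exact h2
  · rw [hdet]
    exact hs
  · rintro v' p hp ⟨m₀, hm₀, hpm₀⟩
    rw [hdet]
    -- The values at `p` of the monomials of weight `t` form a nonzero kernel vector.
    refine Matrix.exists_mulVec_eq_zero_iff.mp
      ⟨fun m => eval p (monomial m.1 1), Function.ne_iff.mpr ⟨⟨m₀, hm₀⟩, hpm₀⟩, funext fun m => ?_⟩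
    have h0 : eval p (monomial (s m).2 1 * g (s m).1 v') = 0 := by rw [map_mul, hp, mul_zero]
    simp only [Matrix.mulVec, dotProduct, Matrix.of_apply, Pi.zero_apply]
    by_cases hu : Finsupp.weight wt (s m).2 + n (s m).1 = t
    · rw [← h0]
      conv_rhs => rw [as_sum (monomial (s m).2 1 * g (s m).1 v'), map_sum]
      have hsub : ∀ b ∈ (monomial (s m).2 1 * g (s m).1 v').support, Finsupp.weight wt b = t :=
        fun b hb => (hhom (s m) v' (mem_support_iff.mp hb)).trans hu
      rw [← Finset.sum_subtype_of_mem (p := fun m => Finsupp.weight wt m = t) _ hsub]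
      symm
      refine Finset.sum_subset_zero_on_sdiff (Finset.subset_univ _) ?_ ?_
      · intro b hb
        have : coeff b.1 (monomial (s m).2 1 * g (s m).1 v') = 0 := by
          simpa using hb
        rw [hL, this, zero_mul]
      · intro b _
        rw [hL]
        simp [eval_monomial]
    · refine Finset.sum_eq_zero fun m' _ => ?_
      simp [L, hu]

end Elimination

/-! ### Closedness of the set of singular tuples. -/

section Closed

variable {c N : ℕ} {d : Fin c → ℕ} {K : Type*} [Field K]

/-- The bidegrees of the variables `Y_i` and `X_j`: the forms `F_i`, `∑ Y_i ∂_j F_i` are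
homogeneous for them. -/
def bidegree (d : Fin c → ℕ) : Fin c ⊕ Fin (N + 1) → ℤ × ℤ :=
  Sum.elim (fun i => (-(d i : ℤ), 1)) (fun _ => (1, 0))

theorem weight_bidegree (m : Fin c ⊕ Fin (N + 1) →₀ ℕ) :
    Finsupp.weight (bidegree d) m =
      (∑ j, (m (Sum.inr j) : ℤ) - ∑ i, (m (Sum.inl i) : ℤ) * d i, ∑ i, (m (Sum.inl i) : ℤ)) := by
  rw [Finsupp.weight_apply, Finsupp.sum_fintype _ _ (by simp),
    Fintype.sum_sum_type]
  ext
  · simp [bidegree, Prod.fst_sum]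
    ring
  · simp [bidegree, Prod.snd_sum]

theorem isWeightedHomogeneous_rename_inr {F : MvPolynomial (Fin (N + 1)) K} {n : ℕ}
    (hF : F.IsHomogeneous n) :
    MvPolynomial.IsWeightedHomogeneous (bidegree d) (MvPolynomial.rename Sum.inr F) (n, 0) := by
  intro m hm
  obtain ⟨u, rfl, hu⟩ := MvPolynomial.coeff_rename_ne_zero _ _ _ hm
  rw [weight_bidegree]
  have h := hF hu
  rw [Finsupp.weight_apply, Finsupp.sum_fintype _ _ (by simp)] at h
  have hinl : ∀ i : Fin c, Finsupp.mapDomain (Sum.inr : _ → Fin c ⊕ Fin (N + 1)) u (Sum.inl i) = 0 :=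
    fun i => Finsupp.mapDomain_of_notMem_range _ _ (by simp)
  simp only [hinl, Finsupp.mapDomain_apply Sum.inr_injective]
  ext
  · simpa using congrArg (Nat.cast (R := ℤ)) h
  · simp

/-- The system of equations expressing that a tuple of forms is singular at `X` with coefficients
`Y`, depending linearly on the tuple. -/
noncomputable def singularSystem (K : Type*) [Field K] (N : ℕ) (d : Fin c → ℕ) :
    Fin c ⊕ Fin (N + 1) →
      (FormTuple K N d →ₗ[K] MvPolynomial (Fin c ⊕ Fin (N + 1)) K) :=
  Sum.elim
    (fun i => (MvPolynomial.rename Sum.inr).toLinearMap ∘ₗ Submodule.subtype _ ∘ₗ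
      LinearMap.proj i)
    (fun j => ∑ i, LinearMap.mulLeft K (MvPolynomial.X (Sum.inl i)) ∘ₗ
      (MvPolynomial.rename Sum.inr).toLinearMap ∘ₗ
        (MvPolynomial.pderiv (R := K) j).toLinearMap ∘ₗ Submodule.subtype _ ∘ₗ LinearMap.proj i)

theorem singularSystem_inl (F : FormTuple K N d) (i : Fin c) :
    singularSystem K N d (Sum.inl i) F = MvPolynomial.rename Sum.inr (F i).1 := rfl

theorem singularSystem_inr (F : FormTuple K N d) (j : Fin (N + 1)) :
    singularSystem K N d (Sum.inr j) F = ∑ i, MvPolynomial.X (Sum.inl i) *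
      MvPolynomial.rename Sum.inr (MvPolynomial.pderiv j (F i).1) := by
  simp [singularSystem]

theorem isSingularAt_iff (F : FormTuple K N d) (p : Fin c ⊕ Fin (N + 1) → K) :
    IsSingularAt F (p ∘ Sum.inl) (p ∘ Sum.inr) ↔
      ∀ s, MvPolynomial.eval p (singularSystem K N d s F) = 0 := by
  simp only [Sum.forall, singularSystem_inl, singularSystem_inr, map_sum, map_mul,
    MvPolynomial.eval_rename, MvPolynomial.eval_X, IsSingularAt, Function.comp_apply]

/-- Giving `Y_i` first weight `-d_i` puts every `Y_i ∂_j F_i` in first weight `-1`, although the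
`d_i` differ. -/
theorem isWeightedHomogeneous_singularSystem (hd : ∀ i, 1 ≤ d i) (s : Fin c ⊕ Fin (N + 1))
    (F : FormTuple K N d) :
    MvPolynomial.IsWeightedHomogeneous (bidegree d) (singularSystem K N d s F)
      (Sum.elim (fun i => ((d i : ℤ), 0)) (fun _ => (-1, 1)) s) := by
  cases s with
  | inl i => exact isWeightedHomogeneous_rename_inr (F i).2
  | inr j =>
    rw [singularSystem_inr]
    refine MvPolynomial.IsWeightedHomogeneous.sum _ _ _ fun i _ => ?_
    have h1 := (MvPolynomial.isWeightedHomogeneous_X K (bidegree (N := N) d) (Sum.inl i)).mul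
      (isWeightedHomogeneous_rename_inr (d := d)
        (MvPolynomial.IsHomogeneous.pderiv (i := j) (F i).2))
    convert! h1 using 1
    ext
    · simp [bidegree, Nat.cast_sub (hd i)]
      ring
    · simp [bidegree]

/-- The weight, depending on an exponent `r`, all of whose monomials are divisible by some
`(X_j Y_i)^r`. -/
def largeBidegree (c N r : ℕ) : ℤ × ℤ := (((N + 1) * r : ℕ), (c * r : ℕ))

/-- The second weight fixes the total degree in `Y`; the first then bounds the degree in `X`. -/
theorem finite_largeBidegree (r : ℕ) :
    {m : Fin c ⊕ Fin (N + 1) →₀ ℕ |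
      Finsupp.weight (bidegree d) m = largeBidegree c N r}.Finite := by
  let B : ℕ := c * r + ((N + 1) * r + ∑ i, (c * r) * d i)
  refine (Set.finite_Iic (Finsupp.equivFunOnFinite.symm fun _ => B)).subset ?_
  intro m hm
  rw [Set.mem_ofPred_eq, weight_bidegree, largeBidegree, Prod.mk.injEq] at hm
  obtain ⟨h1, h2⟩ := hm
  have h2' : ∑ i, m (Sum.inl i) = c * r := by exact_mod_cast h2
  have hl : ∀ i, m (Sum.inl i) ≤ c * r := fun i =>
    h2' ▸ Finset.single_le_sum (f := fun i => m (Sum.inl i)) (fun _ _ => Nat.zero_le _)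
      (Finset.mem_univ i)
  have h1' : ∑ j, m (Sum.inr j) = (N + 1) * r + ∑ i, m (Sum.inl i) * d i := by
    have : (∑ j, (m (Sum.inr j) : ℤ)) = ((N + 1) * r : ℕ) + ∑ i, (m (Sum.inl i) : ℤ) * d i := by
      linarith
    exact_mod_cast this
  have h3 : ∑ i, m (Sum.inl i) * d i ≤ ∑ i, (c * r) * d i :=
    Finset.sum_le_sum fun i _ => Nat.mul_le_mul_right _ (hl i)
  intro s
  cases s with
  | inl i => exact (hl i).trans (Nat.le_add_right _ _)
  | inr j =>
    have : m (Sum.inr j) ≤ ∑ j, m (Sum.inr j) :=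
      Finset.single_le_sum (f := fun j => m (Sum.inr j)) (fun _ _ => Nat.zero_le _)
        (Finset.mem_univ j)
    change m (Sum.inr j) ≤ B
    omega

/-- Pigeonhole: the `c` exponents of `Y` sum to `c r`, and the `N + 1` exponents of `X` to at least
`(N + 1) r`. -/
theorem exists_le_of_largeBidegree (hc : 1 ≤ c) {r : ℕ} {m : Fin c ⊕ Fin (N + 1) →₀ ℕ}
    (hm : Finsupp.weight (bidegree d) m = largeBidegree c N r) :
    ∃ i j, Finsupp.single (Sum.inl i) r + Finsupp.single (Sum.inr j) r ≤ m := by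
  rw [weight_bidegree, largeBidegree, Prod.mk.injEq] at hm
  obtain ⟨h1, h2⟩ := hm
  have : Nonempty (Fin c) := ⟨⟨0, hc⟩⟩
  have h2' : ∑ i, m (Sum.inl i) = c * r := by exact_mod_cast h2
  have h1' : ∑ j, m (Sum.inr j) = (N + 1) * r + ∑ i, m (Sum.inl i) * d i := by
    have : (∑ j, (m (Sum.inr j) : ℤ)) = ((N + 1) * r : ℕ) + ∑ i, (m (Sum.inl i) : ℤ) * d i := by
      linarith
    exact_mod_cast this
  obtain ⟨i, -, hi⟩ := Finset.exists_le_of_sum_le (s := Finset.univ) (f := fun _ : Fin c => r)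
    (g := fun i => m (Sum.inl i)) Finset.univ_nonempty (by simp [h2'])
  obtain ⟨j, -, hj⟩ := Finset.exists_le_of_sum_le (s := Finset.univ) (f := fun _ : Fin (N + 1) => r)
    (g := fun j => m (Sum.inr j)) Finset.univ_nonempty (by simp [h1'])
  refine ⟨i, j, fun s => ?_⟩
  cases s with
  | inl i' =>
    by_cases h : i = i'
    · subst h; simpa using hi
    · simp [h]
  | inr j' =>
    by_cases h : j = j'
    · subst h; simpa using hj
    · simp [h]

theorem exists_monomial_ne_zero (r : ℕ) {p : Fin c ⊕ Fin (N + 1) → K} {i : Fin c}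
    {j : Fin (N + 1)} (hi : p (Sum.inl i) ≠ 0) (hj : p (Sum.inr j) ≠ 0) :
    ∃ m, Finsupp.weight (bidegree d) m = largeBidegree c N r ∧
      MvPolynomial.eval p (MvPolynomial.monomial m (1 : K)) ≠ 0 := by
  -- The extra `c r d_i` in the exponent of `X_j` offsets the weight `-d_i` of `Y_i`.
  refine ⟨Finsupp.single (Sum.inl i) (c * r) +
    Finsupp.single (Sum.inr j) ((N + 1) * r + c * r * d i), ?_, ?_⟩
  · rw [map_add, Finsupp.weight_single, Finsupp.weight_single]
    ext
    · simp [bidegree, largeBidegree]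
    · simp [bidegree, largeBidegree]
  · rw [← one_mul (1 : K), ← MvPolynomial.monomial_mul, map_mul, MvPolynomial.eval_monomial,
      MvPolynomial.eval_monomial, Finsupp.prod_single_index (by simp),
      Finsupp.prod_single_index (by simp), one_mul, one_mul]
    exact mul_ne_zero (pow_ne_zero _ hi) (pow_ne_zero _ hj)

/-- The set of tuples of forms having a singular point is Zariski closed. -/
theorem exists_isHomogeneous_of_forall_not_isSingularAt [IsAlgClosed K] (hc : 1 ≤ c)
    (hd : ∀ i, 1 ≤ d i) (F : FormTuple K N d)
    (hF : ∀ y z, y ≠ 0 → z ≠ 0 → ¬ IsSingularAt F y z) :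
    ∃ (k : ℕ) (f : MvPolynomial (MonomialIndex N d) K), f.IsHomogeneous k ∧
      MvPolynomial.eval (coeffEquiv K N d F) f ≠ 0 ∧
      ∀ (G : FormTuple K N d) y z, y ≠ 0 → z ≠ 0 → IsSingularAt G y z →
        MvPolynomial.eval (coeffEquiv K N d G) f = 0 := by
  set I := Ideal.span (Set.range fun s => singularSystem K N d s F) with hI
  -- Nullstellensatz: solutions of the system have `y = 0` or `z = 0`, so each `Y_i X_j` vanishes on
  -- all of them.
  have hrad : ∀ s : Fin c × Fin (N + 1),
      MvPolynomial.X (Sum.inl s.1) * MvPolynomial.X (Sum.inr s.2) ∈ I.radical := by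
    rintro ⟨i, j⟩
    rw [← MvPolynomial.vanishingIdeal_zeroLocus_eq_radical (K := K)]
    intro p hp
    by_contra hne
    rw [map_mul, MvPolynomial.aeval_X, MvPolynomial.aeval_X] at hne
    refine hF (p ∘ Sum.inl) (p ∘ Sum.inr) (Function.ne_iff.mpr ⟨i, left_ne_zero_of_mul hne⟩)
      (Function.ne_iff.mpr ⟨j, right_ne_zero_of_mul hne⟩) ?_
    rw [isSingularAt_iff]
    intro s
    rw [← MvPolynomial.coe_aeval_eq_eval]
    exact hp _ (Ideal.subset_span ⟨s, rfl⟩)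
  choose r hr using hrad
  let R := ∑ s, r s
  have hR : ∀ i j, MvPolynomial.monomial
      (Finsupp.single (Sum.inl i) R + Finsupp.single (Sum.inr j) R) (1 : K) ∈ I := by
    intro i j
    have h : r (i, j) ≤ R := Finset.single_le_sum (fun _ _ => Nat.zero_le _) (Finset.mem_univ _)
    have h1 := I.pow_mem_of_pow_mem (hr (i, j)) h
    rw [mul_pow, MvPolynomial.X_pow_eq_monomial, MvPolynomial.X_pow_eq_monomial,
      MvPolynomial.monomial_mul, one_mul] at h1
    exact h1
  obtain ⟨k, f, hf, hfF, hfG⟩ := exists_resultant (bidegree d) (largeBidegree c N R)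
    (finite_largeBidegree R)
    (fun s => singularSystem K N d s ∘ₗ (coeffEquiv K N d).symm.toLinearMap) _
    (fun s v => isWeightedHomogeneous_singularSystem hd s _) (coeffEquiv K N d F) (by
      intro m hm
      simp only [LinearMap.comp_apply, LinearEquiv.coe_coe, LinearEquiv.symm_apply_apply]
      obtain ⟨i, j, hij⟩ := exists_le_of_largeBidegree hc hm
      rw [← tsub_add_cancel_of_le hij, ← one_mul (1 : K), ← MvPolynomial.monomial_mul]
      exact I.mul_mem_left _ (hR i j))
  refine ⟨k, f, hf, hfF, fun G y z hy hz hG => hfG _ (Sum.elim y z) ?_ ?_⟩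
  · simp only [LinearMap.comp_apply, LinearEquiv.coe_coe, LinearEquiv.symm_apply_apply]
    rw [← isSingularAt_iff]
    exact hG
  · obtain ⟨i, hi⟩ := Function.ne_iff.mp hy
    obtain ⟨j, hj⟩ := Function.ne_iff.mp hz
    exact exists_monomial_ne_zero R (i := i) (j := j) hi hj

end Closed

/-! ### The Jacobian criterion for smoothness of codimension `c`. -/

section Jacobian

/-- The affine scheme cut out by the polynomials `v` is standard smooth where a maximal minor of the
Jacobian matrix is invertible. -/
theorem isStandardSmooth_localization_jacobian {R σ ι : Type*} [CommRing R] [Finite σ] [Fintype ι]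
    [DecidableEq ι] (v : ι → MvPolynomial σ R) (a : ι → σ) (ha : Function.Injective a) {n : ℕ}
    (hn : n + Fintype.card ι = Nat.card σ) :
    Algebra.IsStandardSmoothOfRelativeDimension n R (Localization.Away
      (Ideal.Quotient.mk (Ideal.span (Set.range v))
        (Matrix.of fun i j => MvPolynomial.pderiv (a i) (v j)).det)) := by
  set g := Ideal.Quotient.mk (Ideal.span (Set.range v))
    (Matrix.of fun i j => MvPolynomial.pderiv (a i) (v j)).det
  let P : Algebra.PreSubmersivePresentation R (MvPolynomial σ R ⧸ Ideal.span (Set.range v)) σ ι :=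
    Algebra.PreSubmersivePresentation.naive a ha
  have hP : P.jacobian = g := by
    rw [P.jacobian_eq_jacobiMatrix_det]
    have : P.jacobiMatrix = Matrix.of fun i j => MvPolynomial.pderiv (a i) (v j) := by
      ext1 i j
      exact Algebra.PreSubmersivePresentation.jacobiMatrix_naive a ha _ _ i j
    rw [this]
    rfl
  -- Localizing adds one variable and one equation, so the relative dimension is unchanged, while
  -- the Jacobian becomes a unit.
  let Q := Algebra.SubmersivePresentation.localizationAway (Localization.Away g) g
  let T : Algebra.SubmersivePresentation R (Localization.Away g) (Unit ⊕ σ) (Unit ⊕ ι) :=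
    { Q.toPreSubmersivePresentation.comp P with
      jacobian_isUnit := by
        have := Q.toPreSubmersivePresentation.comp_jacobian_eq_jacobian_smul_jacobian P
        rw [this, hP, Algebra.smul_def]
        exact (IsLocalization.Away.algebraMap_isUnit g).mul Q.jacobian_isUnit }
  refine T.isStandardSmoothOfRelativeDimension ?_
  rw [Algebra.Presentation.dimension, Nat.card_sum, Nat.card_sum, ← hn, Nat.card_eq_fintype_card (α := ι)]
  omega

variable {c N : ℕ} {d : Fin c → ℕ} {K : Type*} [Field K]

theorem eval_smul_of_isHomogeneous {σ : Type*} [Fintype σ] {f : MvPolynomial σ K} {n : ℕ}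
    (hf : f.IsHomogeneous n) (s : K) (x : σ → K) :
    MvPolynomial.eval (s • x) f = s ^ n * MvPolynomial.eval x f := by
  rw [MvPolynomial.eval_eq', MvPolynomial.eval_eq', Finset.mul_sum]
  refine Finset.sum_congr rfl fun m hm => ?_
  have hdeg : ∑ i, m i = n := by
    rw [← Finsupp.degree_eq_sum]
    by_contra h
    exact MvPolynomial.mem_support_iff.mp hm (hf.coeff_eq_zero h)
  simp only [Pi.smul_apply, smul_eq_mul, mul_pow, Finset.prod_mul_distrib]
  rw [Finset.prod_pow_eq_pow_sum, hdeg]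
  ring

/-- Since `∂_j F_i` has degree `d_i - 1`, the coefficients must be rescaled by different powers of
`s`. -/
theorem IsSingularAt.smul_right {F : FormTuple K N d} {y : Fin c → K} {z : Fin (N + 1) → K}
    (h : IsSingularAt F y z) {s : K} (hs : s ≠ 0) :
    IsSingularAt F (fun i => (s ^ (d i - 1))⁻¹ * y i) (s • z) := by
  constructor
  · intro i
    rw [eval_smul_of_isHomogeneous (F i).2, h.1 i, mul_zero]
  · intro j
    rw [← h.2 j]
    refine Finset.sum_congr rfl fun i _ => ?_
    rw [eval_smul_of_isHomogeneous (MvPolynomial.IsHomogeneous.pderiv (i := j) (F i).2)]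
    field_simp

theorem isSmoothOfCodim_of_forall_not_isSingularAt [IsAlgClosed K] (F : FormTuple K N d)
    (hF : ∀ y z, y ≠ 0 → z ≠ 0 → ¬ IsSingularAt F y z) : IsSmoothOfCodim F := by
  classical
  intro j
  let v : Option (Fin c) → MvPolynomial (Fin (N + 1)) K :=
    fun o => o.elim (MvPolynomial.X j - 1) fun i => (F i).1
  suffices H : ∀ S : Set (MvPolynomial (Fin (N + 1)) K), S = Set.range v →
      ∀ p : PrimeSpectrum (MvPolynomial (Fin (N + 1)) K ⧸ Ideal.span S), ∃ n : ℕ, n + c = N ∧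
        ∃ g ∉ p.asIdeal, Algebra.IsStandardSmoothOfRelativeDimension n K (Localization.Away g) by
    refine H _ ?_
    ext f
    simp only [Set.mem_insert_iff, Set.mem_range, Option.exists, v, Option.elim]
    exact or_congr eq_comm Iff.rfl
  rintro _ rfl p
  -- It suffices to find a minor that is nonzero at a closed point in the closure of `p`.
  obtain ⟨m, hm, hpm⟩ := Ideal.exists_le_maximal p.asIdeal p.2.ne_top
  have hmax : (m.comap (Ideal.Quotient.mk (Ideal.span (Set.range v)))).IsMaximal :=
    Ideal.comap_isMaximal_of_surjective _ Ideal.Quotient.mk_surjective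
  obtain ⟨x, hx⟩ := MvPolynomial.isMaximal_iff_eq_vanishingIdeal_singleton.mp hmax
  have hmem : ∀ f, Ideal.Quotient.mk (Ideal.span (Set.range v)) f ∈ m ↔
      MvPolynomial.eval x f = 0 := by
    intro f
    rw [← Ideal.mem_comap, hx, MvPolynomial.mem_vanishingIdeal_singleton_iff,
      MvPolynomial.aeval_eq_eval]
  have hv : ∀ o, MvPolynomial.eval x (v o) = 0 := by
    intro o
    rw [← hmem, Ideal.Quotient.eq_zero_iff_mem.mpr (Ideal.subset_span (Set.mem_range_self o))]
    exact m.zero_mem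
  have hxj : x j = 1 := by simpa [v, sub_eq_zero] using hv none
  have hFx : ∀ i, MvPolynomial.eval x (F i).1 = 0 := fun i => hv (some i)
  obtain ⟨s, hs, hdet⟩ := exists_det_ne_zero
    (fun u o => MvPolynomial.eval x (MvPolynomial.pderiv u (v o))) (by
      intro y hy
      have hy' : ∀ u, y none * (if u = j then 1 else 0) + ∑ i, y (some i) *
          MvPolynomial.eval x (MvPolynomial.pderiv u (F i).1) = 0 := by
        intro u
        have := hy u
        rw [Fintype.sum_option] at this
        simpa [v, MvPolynomial.pderiv_X, Pi.single_apply, apply_ite, eq_comm] using this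
      -- Pair the relation with `x`. By Euler's identity the `F_i` contribute multiples of `F_i(x) =
      -- 0`, which leaves `y none * x j`, and `x j = 1`.
      have hnone : y none = 0 := by
        have h1 : ∑ u, x u * (y none * (if u = j then 1 else 0) + ∑ i, y (some i) *
          MvPolynomial.eval x (MvPolynomial.pderiv u (F i).1)) = 0 :=
          Finset.sum_eq_zero fun u _ => by rw [hy' u, mul_zero]
        simp only [mul_add, Finset.sum_add_distrib, Finset.mul_sum] at h1
        rw [Finset.sum_comm (s := Finset.univ) (t := Finset.univ) (γ := Fin (N + 1))] at h1
        have h2 : ∀ i, ∑ u, x u * (y (some i) *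
            MvPolynomial.eval x (MvPolynomial.pderiv u (F i).1)) = 0 := by
          intro i
          have := congrArg (MvPolynomial.eval x) (F i).2.sum_X_mul_pderiv
          rw [map_nsmul, hFx i, smul_zero, map_sum] at this
          simp only [map_mul, MvPolynomial.eval_X] at this
          simp only [mul_left_comm (x _)]
          rw [← Finset.mul_sum, this, mul_zero]
        simpa [h2, hxj] using h1
      have hsome : (fun i => y (some i)) = 0 := by
        by_contra hne
        refine hF _ x hne (fun h => ?_) ⟨hFx, fun u => ?_⟩
        · simp [h] at hxj
        · simpa [hnone] using hy' u
      funext o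
      cases o with
      | none => exact hnone
      | some i => exact congrFun hsome i)
  -- An invertible minor of size `c + 1` in `N + 1` variables forces `c ≤ N`; so for `c = N + 1` the
  -- chart has no points.
  have hcard := Fintype.card_le_of_injective s hs
  rw [Fintype.card_option, Fintype.card_fin, Fintype.card_fin] at hcard
  refine ⟨N - c, by omega, _, fun hg => ?_, isStandardSmooth_localization_jacobian v s hs ?_⟩
  · have := (hmem _).mp (hpm hg)
    rw [RingHom.map_det] at this
    exact hdet this
  · rw [Fintype.card_option, Fintype.card_fin, Nat.card_fin]
    omega

/-- A point of a standard smooth algebra of relative dimension `n` has a tangent space of dimension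
at most `n`: all tangent vectors, recorded by their values on elements `x`, are in the image of one
linear map from `K^n`. -/
theorem exists_linearMap_of_isStandardSmooth {A σ : Type*} [CommRing A] [Algebra K A] (n : ℕ)
    [Algebra.IsStandardSmoothOfRelativeDimension n K A] (π : A →ₐ[K] K) (x : σ → A) :
    ∃ M : (Fin n → K) →ₗ[K] (σ → K), ∀ θ : A →ₐ[K] DualNumber K, (∀ a, (θ a).fst = π a) →
      (fun l => (θ (x l)).snd) ∈ LinearMap.range M := by
  have hnt : Nontrivial A := π.toRingHom.domain_nontrivial
  have : Algebra.IsStandardSmooth K A :=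
    Algebra.IsStandardSmoothOfRelativeDimension.isStandardSmooth n
  have hrank := Algebra.IsStandardSmoothOfRelativeDimension.rank_kaehlerDifferential
    (R := K) (S := A) n
  have hfin : Module.Finite A (Ω[A⁄K]) := Module.finite_of_rank_eq_nat hrank
  let b : Module.Basis (Fin n) A (Ω[A⁄K]) :=
    Module.finBasisOfFinrankEq A _ (Module.finrank_eq_of_rank_eq hrank)
  let : Algebra A K := π.toRingHom.toAlgebra
  have : IsScalarTower K A K := IsScalarTower.of_algebraMap_eq fun r => (π.commutes r).symm
  refine ⟨LinearMap.pi fun l => ∑ k, π (b.repr (KaehlerDifferential.D K A (x l)) k) •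
    LinearMap.proj k, fun θ hθ => ?_⟩
  let D : Derivation K A K := Derivation.mk' (TrivSqZeroExt.sndHom K K ∘ₗ θ.toLinearMap) <| by
    intro a a'
    simp only [LinearMap.comp_apply, AlgHom.toLinearMap_apply, map_mul, TrivSqZeroExt.sndHom_apply,
      TrivSqZeroExt.snd_mul, hθ, Algebra.smul_def]
    rw [MulOpposite.smul_eq_mul_unop, mul_comm _ (MulOpposite.unop _)]
    rfl
  refine ⟨fun k => D.liftKaehlerDifferential (b k), funext fun l => ?_⟩
  have h1 : D (x l) = (θ (x l)).snd := rfl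
  rw [← h1, ← D.liftKaehlerDifferential_comp_D (x l)]
  conv_rhs => rw [← b.sum_repr (KaehlerDifferential.D K A (x l)), map_sum]
  simp only [LinearMap.pi_apply, LinearMap.sum_apply, LinearMap.smul_apply, LinearMap.proj_apply,
    map_smul]
  rfl

/-- Dimension count: the tangent space at `z` of a chart is cut out of `K^{N+1}` by `v_j = 0` and
`c` differentials, one of them redundant. Its dimension is thus at least `N + 1 - c`, whereas
smoothness allows only `N - c`. -/
theorem not_isSmoothOfCodim_of_isSingularAt (F : FormTuple K N d) {y : Fin c → K}
    {z : Fin (N + 1) → K} (hy : y ≠ 0) (hz : z ≠ 0) (h : IsSingularAt F y z) :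
    ¬ IsSmoothOfCodim F := by
  obtain ⟨j, hj⟩ := Function.ne_iff.mp hz
  obtain ⟨i₀, hi₀⟩ := Function.ne_iff.mp hy
  simp only [Pi.zero_apply] at hj hi₀
  wlog hzj : z j = 1 generalizing y z
  · refine this (y := fun i => ((z j)⁻¹ ^ (d i - 1))⁻¹ * y i) (z := (z j)⁻¹ • z) ?_ ?_
      (h.smul_right (inv_ne_zero hj)) ?_ ?_ ?_
    · exact Function.ne_iff.mpr ⟨i₀, by simp [hj, hi₀]⟩
    · exact Function.ne_iff.mpr ⟨j, by simp [hj]⟩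
    · simp [hj]
    · simp [hj, hi₀]
    · simp [hj]
  intro hsmooth
  set I := Ideal.span (insert (MvPolynomial.X j - 1 : MvPolynomial (Fin (N + 1)) K)
      (Set.range fun i => (F i : MvPolynomial (Fin (N + 1)) K))) with hI
  have hlift : ∀ (C : Type _) [CommRing C] [Algebra K C] (Z : Fin (N + 1) → C), Z j = 1 →
      (∀ i, MvPolynomial.aeval Z (F i).1 = 0) → ∀ f ∈ I, MvPolynomial.aeval Z f = 0 := by
    intro C _ _ Z hZ hFZ f hf
    have : I ≤ RingHom.ker (MvPolynomial.aeval Z : MvPolynomial (Fin (N + 1)) K →ₐ[K] C) := by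
      rw [hI, Ideal.span_le]
      rintro _ (rfl | ⟨i, rfl⟩)
      · simp [hZ]
      · exact hFZ i
    exact this hf
  let π₀ : chartRing F j →ₐ[K] K := Ideal.Quotient.liftₐ I (MvPolynomial.aeval z)
    (hlift K z hzj fun i => by rw [MvPolynomial.aeval_eq_eval]; exact h.1 i)
  obtain ⟨n, hn, g, hg, hsm⟩ := hsmooth j ⟨RingHom.ker π₀, RingHom.ker_isPrime _⟩
  have hg' : π₀ g ≠ 0 := hg
  let π : Localization.Away g →ₐ[K] K := IsLocalization.liftAlgHom (M := .powers g) (f := π₀) <| by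
    rintro ⟨_, k, rfl⟩
    rw [map_pow]
    exact (isUnit_iff_ne_zero.mpr hg').pow k
  obtain ⟨M, hM⟩ := exists_linearMap_of_isStandardSmooth n π
    (fun l => algebraMap (chartRing F j) _ (Ideal.Quotient.mk I (MvPolynomial.X l)))
  have htangent : ∀ v : Fin (N + 1) → K, v j = 0 →
      (∀ i, ∑ l, MvPolynomial.eval z (MvPolynomial.pderiv l (F i).1) * v l = 0) →
      v ∈ LinearMap.range M := by
    intro v hvj hvF
    let Z : Fin (N + 1) → DualNumber K :=
      fun l => TrivSqZeroExt.inl (z l) + TrivSqZeroExt.inr (v l)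
    have hZfst : (fun l => (Z l).fst) = z := by funext l; simp [Z]
    have hZsnd : ∀ l, (Z l).snd = v l := fun l => by simp [Z]
    let θ₀ : chartRing F j →ₐ[K] DualNumber K := Ideal.Quotient.liftₐ I (MvPolynomial.aeval Z)
      (hlift _ Z (by simp [Z, hzj, hvj]) fun i => by
        apply TrivSqZeroExt.ext
        · rw [fst_aeval_dualNumber, hZfst, h.1 i, TrivSqZeroExt.fst_zero]
        · simp only [snd_aeval_dualNumber, hZfst, hZsnd, hvF i, TrivSqZeroExt.snd_zero])
    have hθ₀ : ∀ a, (θ₀ a).fst = π₀ a := by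
      intro a
      obtain ⟨f, rfl⟩ := Ideal.Quotient.mk_surjective a
      change (MvPolynomial.aeval Z f).fst = MvPolynomial.aeval z f
      rw [fst_aeval_dualNumber, hZfst, MvPolynomial.aeval_eq_eval]
    let θ : Localization.Away g →ₐ[K] DualNumber K :=
      IsLocalization.liftAlgHom (M := .powers g) (f := θ₀) <| by
        rintro ⟨_, k, rfl⟩
        rw [map_pow]
        refine IsUnit.pow k ?_
        rw [TrivSqZeroExt.isUnit_iff_isUnit_fst, hθ₀]
        exact isUnit_iff_ne_zero.mpr hg'
    have hθ : ∀ a, (θ a).fst = π a := by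
      have : (TrivSqZeroExt.fstHom K K K).comp θ = π := by
        apply IsLocalization.algHom_ext (.powers g)
        ext a
        change (θ (algebraMap _ _ _)).fst = π (algebraMap _ _ _)
        simp only [θ, π, IsLocalization.liftAlgHom_apply, IsLocalization.lift_eq]
        exact hθ₀ _
      exact fun a => congrArg (fun φ : Localization.Away g →ₐ[K] K => φ a) this
    have := hM θ hθ
    convert! this using 1
    funext l
    simp only [θ, IsLocalization.liftAlgHom_apply, IsLocalization.lift_eq]
    change v l = (MvPolynomial.aeval Z (MvPolynomial.X l)).snd
    rw [MvPolynomial.aeval_X, hZsnd]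
  -- The equation of index `i₀` follows from the others because `y i₀ ≠ 0`; its slot is used for
  -- `v_j = 0`, so `L` has only `c` components.
  let L : (Fin (N + 1) → K) →ₗ[K] (Fin c → K) := LinearMap.pi fun i =>
    if i = i₀ then LinearMap.proj j else
      ∑ l, MvPolynomial.eval z (MvPolynomial.pderiv l (F i).1) • LinearMap.proj l
  have hker : LinearMap.ker L ≤ LinearMap.range M := by
    intro v hv
    have hLv : ∀ i, L v i = 0 := congrFun hv
    have hvF : ∀ i, i ≠ i₀ →
        ∑ l, MvPolynomial.eval z (MvPolynomial.pderiv l (F i).1) * v l = 0 := by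
      intro i hi
      simpa [L, hi] using hLv i
    refine htangent v (by simpa [L] using hLv i₀) fun i => ?_
    by_cases hi : i = i₀
    · subst hi
      have h1 : ∑ k, y k * ∑ l, MvPolynomial.eval z (MvPolynomial.pderiv l (F k).1) * v l = 0 := by
        simp only [Finset.mul_sum]
        rw [Finset.sum_comm]
        refine Finset.sum_eq_zero fun l _ => ?_
        simp only [← mul_assoc]
        rw [← Finset.sum_mul, h.2 l, zero_mul]
      rw [Finset.sum_eq_single i (fun k _ hk => by rw [hvF k hk, mul_zero]) (by simp)] at h1
      exact (mul_eq_zero.mp h1).resolve_left hi₀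
    · exact hvF i hi
  have h1 := LinearMap.finrank_range_add_finrank_ker L
  have h2 := Submodule.finrank_mono hker
  have h3 := LinearMap.finrank_range_le M
  have h4 := Submodule.finrank_le (LinearMap.range L)
  simp only [Module.finrank_fin_fun] at h1 h3 h4
  omega

end Jacobian

/-! ### Comparison of the discriminant with the dual variety. -/

section Main

variable {c N : ℕ} {d : Fin c → ℕ} {K : Type*} [Field K]

theorem isSmoothOfCodim_iff [IsAlgClosed K] (F : FormTuple K N d) :
    IsSmoothOfCodim F ↔ ∀ y z, y ≠ 0 → z ≠ 0 → ¬ IsSingularAt F y z :=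
  ⟨fun h _ _ hy hz hF => not_isSmoothOfCodim_of_isSingularAt F hy hz hF h,
    isSmoothOfCodim_of_forall_not_isSingularAt F⟩

theorem mem_discriminantLocus_iff [IsAlgClosed K] (F : FormTuple K N d) :
    F ∈ discriminantLocus K N d ↔ ∃ y z, y ≠ 0 ∧ z ≠ 0 ∧ IsSingularAt F y z := by
  rw [discriminantLocus, Set.mem_ofPred_eq, isSmoothOfCodim_iff]
  push Not
  rfl

/-- A hyperplane is tangent to the toric variety at some smooth point if and only if the
corresponding tuple of forms has a singular point. -/
theorem exists_isTangentAt_iff [Infinite K] (hc : 1 ≤ c) (hd : ∀ i, 1 ≤ d i)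
    (H : ℙ K (MonomialIndex N d → K)) :
    (∃ x ∈ projToric K (monomialChar (N := N) d),
      IsSmoothPoint (projToric K (monomialChar (N := N) d)) x ∧
        IsTangentAt (projToric K (monomialChar (N := N) d)) H x) ↔
      ∃ y z, y ≠ 0 ∧ z ≠ 0 ∧ IsSingularAt ((coeffEquiv K N d).symm H.rep) y z := by
  constructor
  · rintro ⟨x, hx, -, hT⟩
    obtain ⟨y, z, hy, hz, hyz⟩ :=
      exists_eq_paramPoint hd x.rep ((mem_affineToric_iff hc hd _).mp hx) x.rep_nonzero
    refine ⟨y, z, hy, hz, isSingularAt_of_tangent hc hd _ hyz fun v hv => ?_⟩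
    rw [LinearEquiv.apply_symm_apply]
    exact hT v hv
  · rintro ⟨y, z, hy, hz, h⟩
    obtain ⟨i, hi⟩ := Function.ne_iff.mp hy
    obtain ⟨j, hj⟩ := Function.ne_iff.mp hz
    have hw : paramPoint d y z ≠ 0 := Function.ne_iff.mpr ⟨vertexIndex d i j, by
      rw [paramPoint_vertexIndex]
      exact mul_ne_zero hi (pow_ne_zero _ hj)⟩
    obtain ⟨r, hr⟩ := Projectivization.exists_smul_eq_mk_rep K _ hw
    have hrep : (Projectivization.mk K _ hw).rep = paramPoint d ((r : K) • y) z := by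
      rw [← hr, ← smul_paramPoint]
      rfl
    have hx : Projectivization.mk K _ hw ∈ projToric K (monomialChar (N := N) d) := by
      change (Projectivization.mk K _ hw).rep ∈ affineToric K (monomialChar (N := N) d)
      rw [mem_affineToric_iff hc hd, hrep]
      exact fun f hf => aeval_paramPoint_of_mem_ker _ _ hf
    refine ⟨_, hx, isSmoothPoint_projToric hc hd hx, fun v hv => ?_⟩
    have := tangent_of_isSingularAt hc hd _ hrep (smul_ne_zero r.ne_zero hy) hz (h.smul_left r) v hv
    rwa [LinearEquiv.apply_symm_apply] at this

end Main

theorem proposition3p1 {K : Type*} [Field K] [IsAlgClosed K] (N c : ℕ) (hc : 1 ≤ c)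
    (hcN : c ≤ N + 1) (d : Fin c → ℕ) (hd : ∀ i, 1 ≤ d i) :
    coeffEquiv K N d '' discriminantLocus K N d =
      affineCone (projectiveDual (projToric K (monomialChar (N := N) d))) := by
  have : Infinite K := IsAlgClosed.instInfinite
  have hset : {H | ∃ x ∈ projToric K (monomialChar (N := N) d),
      IsSmoothPoint (projToric K (monomialChar (N := N) d)) x ∧
        IsTangentAt (projToric K (monomialChar (N := N) d)) H x} =
      {H | ∃ y z, y ≠ 0 ∧ z ≠ 0 ∧ IsSingularAt ((coeffEquiv K N d).symm H.rep) y z} :=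
    Set.ext fun H => exists_isTangentAt_iff hc hd H
  rw [projectiveDual, hset]
  apply Set.Subset.antisymm
  · rintro _ ⟨F, hF, rfl⟩ hv k f _ hf
    obtain ⟨y, z, hy, hz, h⟩ := (mem_discriminantLocus_iff F).mp hF
    refine hf _ ⟨y, z, hy, hz, ?_⟩
    obtain ⟨r, hr⟩ := Projectivization.exists_smul_eq_mk_rep K _ hv
    rw [← hr, Units.smul_def, map_smul, LinearEquiv.symm_apply_apply]
    exact h.smul_form r
  · intro v hv
    refine ⟨(coeffEquiv K N d).symm v, ?_, LinearEquiv.apply_symm_apply _ _⟩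
    by_contra hF
    have hF' : ∀ y z, y ≠ 0 → z ≠ 0 → ¬ IsSingularAt ((coeffEquiv K N d).symm v) y z :=
      fun y z hy hz h => hF ((mem_discriminantLocus_iff _).mpr ⟨y, z, hy, hz, h⟩)
    -- The zero tuple is singular everywhere, in accordance with the origin belonging to the cone by
    -- convention.
    have hv0 : v ≠ 0 := by
      rintro rfl
      refine hF' (fun _ => 1) (fun _ => 1) (Function.ne_iff.mpr ⟨⟨0, hc⟩, one_ne_zero⟩)
        (Function.ne_iff.mpr ⟨0, one_ne_zero⟩) ?_
      rw [map_zero]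
      exact ⟨fun i => by simp, fun j => by simp⟩
    obtain ⟨k, f, hf, hfv, hfG⟩ := exists_isHomogeneous_of_forall_not_isSingularAt hc hd _ hF'
    rw [LinearEquiv.apply_symm_apply] at hfv
    -- The resultant `f` vanishes at all tangent hyperplanes, hence at the class of `v` in their
    -- closure, which contradicts `hfv`.
    have h0 := hv hv0 k f hf fun q hq => by
      obtain ⟨y, z, hy, hz, h⟩ := hq
      have := hfG _ y z hy hz h
      rwa [LinearEquiv.apply_symm_apply] at this
    obtain ⟨r, hr⟩ := Projectivization.exists_smul_eq_mk_rep K v hv0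
    rw [← hr, Units.smul_def, eval_smul_of_isHomogeneous hf] at h0
    exact (mul_ne_zero (pow_ne_zero _ r.ne_zero) hfv) h0
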